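/- Let $(X,m)$ and $(Y,\mu)$ be $\sigma$-finite measure spaces; all $L^2$-spaces are real. Let $\mathcal E$ be a positive, closed, densely defined symmetric form in $L^2(X,m)$ with domain $\mathcal D$, and assume that $\mathcal E$ is a semi-Dirichlet form, i.e. $u\in\mathcal D$ implies $|u|\in\mathcal D$ and $\mathcal E[|u|]\le\mathcal E[u]$, where $\mathcal E[u]=\mathcal E(u,u)$. Let $J:\mathcal D\to L^2(Y,\mu)$ be a linear operator with dense range such that $J|u|=|Ju|$ for all $u\in\mathcal D$. For $\lambda\in\mathbb R$ put $\mathcal E_\lambda(u,v)=\mathcal E(u,v)-\lambda(u,v)$ and $$\mathcal H_{\rm har}^J(\lambda)=\{u\in\mathcal D:\ \mathcal E_\lambda(u,v)=0\ \text{ for all } v\in\ker J\}.$$ Assume that $\ker J$ is dense in $L^2(X,m)$, that the restriction $\mathcal E_{\rm D}$ of $\mathcal E$ to $\ker J$ is closed, and that the selfadjoint operator $L_{\rm D}$ associated with $\mathcal E_{\rm D}$ has compact resolvent. Assume that $\mathcal D=\mathcal H_{\rm har}^J(0)\oplus\ker J$, and that for every real $\lambda$ which is not an eigenvalue of $L_{\rm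 D}$ there is $c_\lambda>0$ such that $\mathcal E_\lambda[u]\ge -c_\lambda\|Ju\|^2$ for all $u\in\mathcal H_{\rm har}^J(\lambda)$ and such that $\mathcal H_{\rm har}^J(\lambda)$, with the inner product $\mathcal E_\lambda(u,v)+(1+c_\lambda)(Ju,Jv)$, is a Hilbert space. Let $E_0$ be the smallest eigenvalue of $L_{\rm D}$ and let $\lambda<E_0$. Then $\mathcal D=\mathcal H_{\rm har}^J(\lambda)\oplus\ker J$. Let $P_\lambda$ be the projection of $\mathcal D$ onto $\mathcal H_{\rm har}^J(\lambda)$ along $\ker J$, let $\check{\mathcal E}_\lambda$ be the trace form, with domain $\operatorname{ran}J$ and $\check{\mathcal E}_\lambda(Ju,Jv)=\mathcal E_\lambda(P_\lambda u,P_\lambda v)$, and let $\check L_\lambda$ be the operator in $L^2(Y,\mu)$ associated with $\check{\mathcal E}_\lambda$ (the Dirichlet-to-Neumann operator). Then the strongly continuous semigroup $(e^{-t\check L_\lambda})_{t\ge 0}$ with generator $-\check L_\lambda$ exists and is positivity preserving: if $f\in L^2(Y,\mu)$ and $f\ge 0$, then $e^{-t\check L_\lambda}f\ge 0$ for all $t\ge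 0$. -/

import Mathlib

open MeasureTheory Filter Topology
open scoped NNReal ENNReal

noncomputable section

/-- `B` is an inner product on the real vector space `V`, and `V` is complete for the norm
`u ↦ (B u u) ^ (1/2)`; that is, `(V, B)` is a Hilbert space. -/
structure IsHilbertInner {V : Type*} [AddCommGroup V] [Module ℝ V]
    (B : LinearMap.BilinForm ℝ V) : Prop where
  symm : ∀ u v, B u v = B v u
  pos : ∀ u, u ≠ 0 → 0 < B u u
  complete : ∀ u : ℕ → V,
    (∀ ε > 0, ∃ N, ∀ i ≥ N, ∀ j ≥ N, B (u i - u j) (u i - u j) < ε) →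
      ∃ w : V, Tendsto (fun n => B (u n - w) (u n - w)) atTop (𝓝 0)

/-- A symmetric form in a real Hilbert space: a linear subspace (the domain) together with a
symmetric bilinear form on it. -/
structure SymmForm (H : Type*) [NormedAddCommGroup H] [InnerProductSpace ℝ H] where
  domain : Submodule ℝ H
  bilin : LinearMap.BilinForm ℝ domain
  symm : ∀ u v, bilin u v = bilin v u

namespace SymmForm

variable {H K : Type*} [NormedAddCommGroup H] [InnerProductSpace ℝ H]
  [NormedAddCommGroup K] [InnerProductSpace ℝ K]

/-- The form is positive: `E[u] ≥ 0` for all `u` in the domain. -/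
def IsPositive (E : SymmForm H) : Prop := ∀ u : E.domain, 0 ≤ E.bilin u u

/-- The domain is dense. -/
def IsDenselyDefined (E : SymmForm H) : Prop := Dense (E.domain : Set H)

/-- The shifted form `(u, v) ↦ E(u, v) - lam * (u, v)`, with the same domain. -/
def shift (E : SymmForm H) (lam : ℝ) : LinearMap.BilinForm ℝ E.domain :=
  E.bilin - lam • (innerₗ H).compl₁₂ E.domain.subtype E.domain.subtype

theorem shift_apply (E : SymmForm H) (lam : ℝ) (u v : E.domain) :
    E.shift lam u v = E.bilin u v - lam * inner ℝ (u : H) (v : H) := by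
  simp [shift]

/-- Closedness of a positive form: the domain is a Hilbert space for the form norm
`(E[u] + ‖u‖ ^ 2) ^ (1/2)`. -/
def IsClosedForm (E : SymmForm H) : Prop := IsHilbertInner (E.shift (-1))

/-- The pairs `(u, f)` such that `u` is in the form domain and `E(u, v) = (f, v)` for all `v` in
the form domain. -/
def operatorGraph (E : SymmForm H) : Submodule ℝ (H × H) where
  carrier := {p | ∃ hu : p.1 ∈ E.domain, ∀ v : E.domain,
    E.bilin ⟨p.1, hu⟩ v = inner ℝ p.2 (v : H)}
  zero_mem' := ⟨E.domain.zero_mem, fun v => by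
    have h : E.bilin (0 : E.domain) v = inner ℝ (0 : H) (v : H) := by simp
    exact h⟩
  add_mem' := by
    rintro p q ⟨hp, hp'⟩ ⟨hq, hq'⟩
    refine ⟨E.domain.add_mem hp hq, fun v => ?_⟩
    have h : E.bilin (⟨p.1, hp⟩ + ⟨q.1, hq⟩) v = inner ℝ (p.2 + q.2) (v : H) := by
      rw [map_add, LinearMap.add_apply, hp', hq', inner_add_left]
    exact h
  smul_mem' := by
    rintro c p ⟨hp, hp'⟩
    refine ⟨E.domain.smul_mem c hp, fun v => ?_⟩
    have h : E.bilin (c • ⟨p.1, hp⟩) v = inner ℝ (c • p.2) (v : H) := by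
      rw [map_smul, LinearMap.smul_apply, hp', real_inner_smul_left, smul_eq_mul]
    exact h

/-- The operator `L` associated with a densely defined form by Kato's representation theorem:
`u` is in its domain and `L u = f` if and only if `u` is in the form domain and
`E(u, v) = (f, v)` for all `v` in the form domain. -/
def operator (E : SymmForm H) : H →ₗ.[ℝ] H := E.operatorGraph.toLinearPMap

theorem graph_operator (E : SymmForm H) (hE : E.IsDenselyDefined) :
    E.operator.graph = E.operatorGraph := by
  refine Submodule.toLinearPMap_graph_eq _ ?_
  rintro ⟨u, f⟩ ⟨hu, h⟩ (rfl : u = 0)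
  refine hE.eq_zero_of_inner_left ℝ fun v hv => ?_
  have h0 : E.bilin (0 : E.domain) ⟨v, hv⟩ = 0 := by simp
  exact (h ⟨v, hv⟩).symm.trans h0

section Trace

variable (E : SymmForm H) (J : E.domain →ₗ[ℝ] K)

/-- The Dirichlet form of the pair `(E, J)`: the restriction of `E` to `ker J`. -/
def dirichlet : SymmForm H where
  domain := (LinearMap.ker J).map E.domain.subtype
  bilin := E.bilin.compl₁₂ (Submodule.inclusion (Submodule.map_subtype_le _ _))
    (Submodule.inclusion (Submodule.map_subtype_le _ _))
  symm _ _ := E.symm _ _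

/-- The space of all `u` in the domain of `J` with `E(u, v) - lam * (u, v) = 0` for all
`v` in `ker J`. -/
def harmonic (lam : ℝ) : Submodule ℝ E.domain where
  carrier := {u | ∀ v ∈ LinearMap.ker J, E.shift lam u v = 0}
  zero_mem' := fun v _ => by simp
  add_mem' := fun ha hb v hv => by
    rw [map_add, LinearMap.add_apply, ha v hv, hb v hv, add_zero]
  smul_mem' := fun c a ha v hv => by
    rw [map_smul, LinearMap.smul_apply, ha v hv, smul_zero]

/-- The bilinear form `E(u, v) - lam * (u, v) + a * (J u, J v)` on the domain of `E`. -/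
def shiftAdd (lam a : ℝ) : LinearMap.BilinForm ℝ E.domain :=
  E.shift lam + a • (innerₗ K).compl₁₂ J J

variable {E J}

/-- If the domain of `J` is the direct sum of `harmonic lam` and `ker J`, then `J` maps
`harmonic lam` bijectively onto the range of `J`. -/
def harmonicEquiv {lam : ℝ} (h : IsCompl (E.harmonic J lam) (LinearMap.ker J)) :
    E.harmonic J lam ≃ₗ[ℝ] LinearMap.range J :=
  LinearEquiv.ofBijective (J.rangeRestrict ∘ₗ (E.harmonic J lam).subtype) <| by
    constructor
    · rw [← LinearMap.ker_eq_bot, LinearMap.ker_eq_bot']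
      intro u hu
      have h1 : (u : E.domain) ∈ LinearMap.ker J := congrArg Subtype.val hu
      exact Subtype.ext (Submodule.disjoint_def.mp h.disjoint _ u.2 h1)
    · rintro ⟨_, u, rfl⟩
      obtain ⟨a, ha, b, hb, rfl⟩ := Submodule.mem_sup.mp
        (h.codisjoint.eq_top ▸ Submodule.mem_top : u ∈ E.harmonic J lam ⊔ LinearMap.ker J)
      refine ⟨⟨a, ha⟩, Subtype.ext ?_⟩
      have hb' : J b = 0 := hb
      simp [hb']

/-- The Poisson operator of level `lam`: it maps `J u` to the component in `harmonic lam` of `u`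
in the direct sum decomposition of the domain of `J`. -/
def poisson {lam : ℝ} (h : IsCompl (E.harmonic J lam) (LinearMap.ker J)) :
    LinearMap.range J →ₗ[ℝ] E.domain :=
  (E.harmonic J lam).subtype ∘ₗ (harmonicEquiv h).symm.toLinearMap

/-- The trace form of `E - lam` with respect to `J`. Its domain is the range of `J`; its value at
`J u` is the value of the form `E - lam` at the component of `u` in `harmonic lam`. -/
def trace {lam : ℝ} (h : IsCompl (E.harmonic J lam) (LinearMap.ker J)) : SymmForm K where
  domain := LinearMap.range J
  bilin := (E.shift lam).compl₁₂ (poisson h) (poisson h)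
  symm _ _ := by
    simp only [LinearMap.compl₁₂_apply, shift_apply]
    rw [E.symm, real_inner_comm]

theorem poisson_mem {lam : ℝ} (h : IsCompl (E.harmonic J lam) (LinearMap.ker J))
    (ψ : LinearMap.range J) : poisson h ψ ∈ E.harmonic J lam :=
  ((harmonicEquiv h).symm ψ).2

theorem J_poisson {lam : ℝ} (h : IsCompl (E.harmonic J lam) (LinearMap.ker J))
    (ψ : LinearMap.range J) : J (poisson h ψ) = ψ :=
  congrArg Subtype.val ((harmonicEquiv h).apply_symm_apply ψ)

/-- Dirichlet principle for the trace form. -/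
theorem trace_isLeast {lam : ℝ} (h : IsCompl (E.harmonic J lam) (LinearMap.ker J))
    (ψ : LinearMap.range J) :
    IsLeast {r | ∃ v ∈ E.harmonic J lam, J v = ψ ∧ r = E.shift lam v v}
      ((trace h).bilin ψ ψ) := by
  refine ⟨⟨poisson h ψ, poisson_mem h ψ, J_poisson h ψ, rfl⟩, ?_⟩
  rintro _ ⟨v, hv, hJ, rfl⟩
  have h1 : v - poisson h ψ = 0 := Submodule.disjoint_def.mp h.disjoint _
    (Submodule.sub_mem _ hv (poisson_mem h ψ)) (by simp [hJ, J_poisson])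
  rw [sub_eq_zero.mp h1]
  exact le_rfl

end Trace

end SymmForm

/-- The set of (real) eigenvalues of an unbounded operator. -/
def eigenvalues {H : Type*} [NormedAddCommGroup H] [InnerProductSpace ℝ H]
    (L : H →ₗ.[ℝ] H) : Set ℝ :=
  {e | ∃ u : L.domain, (u : H) ≠ 0 ∧ L u = e • (u : H)}

/-- `L` has compact resolvent: for some `z` in the resolvent set, the bounded operator
`R = (L - z)⁻¹` is compact. -/
def HasCompactResolvent {H : Type*} [NormedAddCommGroup H] [InnerProductSpace ℝ H]
    (L : H →ₗ.[ℝ] H) : Prop :=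
  ∃ (z : ℝ) (R : H →L[ℝ] H), IsCompactOperator R ∧
    (∀ f : H, ∃ u : L.domain, (u : H) = R f ∧ L u - z • (u : H) = f) ∧
    (∀ u : L.domain, R (L u - z • (u : H)) = u)

/-- `T` is the strongly continuous semigroup `e ^ (-t L)`, that is, the strongly continuous
semigroup with generator `-L` (domains included). -/
structure IsSemigroupOf {H : Type*} [NormedAddCommGroup H] [InnerProductSpace ℝ H]
    (L : H →ₗ.[ℝ] H) (T : ℝ≥0 → H →L[ℝ] H) : Prop where
  map_zero : T 0 = ContinuousLinearMap.id ℝ H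
  map_add : ∀ s t, T (s + t) = (T s).comp (T t)
  continuous : ∀ u, Continuous fun t => T t u
  generator : ∀ u f : H, (u, f) ∈ L.graph ↔
    Tendsto (fun t : ℝ≥0 => (t : ℝ)⁻¹ • (u - T t u)) (𝓝[>] 0) (𝓝 f)

/-- A bounded operator on `L²` is positivity preserving. -/
def PositivityPreserving {X : Type*} [MeasurableSpace X] {μ : Measure X}
    (S : Lp ℝ 2 μ →L[ℝ] Lp ℝ 2 μ) : Prop :=
  ∀ f : Lp ℝ 2 μ, 0 ≤ f → 0 ≤ S f

/-- The semi-Dirichlet property of a form on `L²`: the domain is stable under `u ↦ |u|`, and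
`E[|u|] ≤ E[u]`. -/
def SymmForm.IsSemiDirichlet {X : Type*} [MeasurableSpace X] {m : Measure X}
    (E : SymmForm (Lp ℝ 2 m)) : Prop :=
  ∀ u : E.domain, ∃ h : |(u : Lp ℝ 2 m)| ∈ E.domain,
    E.bilin ⟨|(u : Lp ℝ 2 m)|, h⟩ ⟨|(u : Lp ℝ 2 m)|, h⟩ ≤ E.bilin u u

end

/-! The trace form `q` is bounded below by `-c`, and the harmonic space is complete for `q + (1 +
c)‖J u‖²`. Riesz representation there solves `(L + c + κ) ψ = f` for all `κ ≥ 1`, where `L` is the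
operator of `q`. Hence `L + c` is maximal accretive, and Hille–Yosida makes `-L` the generator of `e
^ (c t)` times a contraction semigroup (`IsMaxAccretive.isSemigroupOf`). A Gronwall argument shows
that no other semigroup has this generator (`IsSemigroupOf.unique`).

Positivity is the first Beurling–Deny criterion: if `q[|ψ|] ≤ q[ψ]`, the resolvents preserve the
closed cone of nonnegative functions, hence so do the exponentials of the Yosida approximations and
their limit. To verify the criterion, let `u` be the harmonic extension of `ψ`. Then `J |u| = |ψ|`,
and `E_lam[|u|] ≤ E_lam[u]` because `|u|` and `u` have equal norms. Since `lam < E₀`, the form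
`E_lam` is nonnegative on `ker J`, so the harmonic extension of `|ψ|` minimizes `E_lam` among all
extensions, `|u|` included (`shift_poisson_le`, `trace_isSemiDirichlet`).

Two facts about `L_D` enter, both derived from the Fredholm alternative: the decomposition of the
domain at `lam` (`isCompl_harmonic`) and the lower bound on `ker J`
(`shift_self_nonneg_of_lt_isLeast`). -/

/-! ### Exponentials of bounded operators. -/

section Exponential

variable {A : Type*} [NormedRing A] [NormedAlgebra ℝ A]

theorem exp_smul_one_real (s : ℝ) : NormedSpace.exp (s • (1 : A)) = Real.exp s • (1 : A) := by
  have h := NormedSpace.algebraMap_exp_comm (𝔸 := A) s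
  rw [← Real.exp_eq_exp_ℝ, Algebra.algebraMap_eq_smul_one, Algebra.algebraMap_eq_smul_one] at h
  exact h.symm

variable [CompleteSpace A]

theorem Commute.exp_add_real {a b : A} (h : Commute a b) :
    NormedSpace.exp (a + b) = NormedSpace.exp a * NormedSpace.exp b := by
  let _ : NormedAlgebra ℚ A := NormedAlgebra.restrictScalars ℚ ℝ A
  exact NormedSpace.exp_add_of_commute h

theorem norm_exp_le_exp_norm_of_normOneClass [NormOneClass A] (a : A) :
    ‖NormedSpace.exp a‖ ≤ Real.exp ‖a‖ := by
  have h1 := NormedSpace.exp_series_hasSum_exp' (𝕂 := ℝ) a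
  have h2 := NormedSpace.exp_series_hasSum_exp' (𝕂 := ℝ) ‖a‖
  rw [← Real.exp_eq_exp_ℝ] at h2
  rw [← h1.tsum_eq, ← h2.tsum_eq]
  refine tsum_of_norm_bounded h2.summable.hasSum fun n => ?_
  rw [norm_smul, smul_eq_mul, Real.norm_of_nonneg (by positivity)]
  gcongr
  exact norm_pow_le a n

end Exponential

section Contraction

variable {K : Type*} [NormedAddCommGroup K] [NormedSpace ℝ K] [CompleteSpace K]

/-- Interpolate by `s ↦ e^(s a) e^((t-s) b) u`, whose derivative `e^(s a) e^((t-s) b) (a u - b u)`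
is controlled by contractivity. By commutation the curve equals `e^(s (a-b)) e^(t b) u`, where only
one factor depends on `s`. -/
theorem norm_exp_smul_apply_sub_le {a b : K →L[ℝ] K} (hab : Commute a b)
    (ha : ∀ s : ℝ, 0 ≤ s → ‖NormedSpace.exp (s • a)‖ ≤ 1)
    (hb : ∀ s : ℝ, 0 ≤ s → ‖NormedSpace.exp (s • b)‖ ≤ 1) {t : ℝ} (ht : 0 ≤ t) (u : K) :
    ‖NormedSpace.exp (t • a) u - NormedSpace.exp (t • b) u‖ ≤ t * ‖a u - b u‖ := by
  have hc : Commute (a - b) b := hab.sub_left (Commute.refl b)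
  have key : ∀ s : ℝ, NormedSpace.exp (s • (a - b)) * NormedSpace.exp (t • b)
      = NormedSpace.exp (s • a) * NormedSpace.exp ((t - s) • b) := by
    intro s
    rw [← ((hc.smul_left s).smul_right t).exp_add_real,
      ← ((hab.smul_left s).smul_right (t - s)).exp_add_real]
    congr 1
    module
  have hder : ∀ s ∈ Set.Icc (0 : ℝ) t, HasDerivWithinAt
      (fun s : ℝ => (NormedSpace.exp (s • (a - b)) * NormedSpace.exp (t • b)) u)
      ((NormedSpace.exp (s • (a - b)) * (a - b) * NormedSpace.exp (t • b)) u) (Set.Icc 0 t) s := by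
    intro s _
    have h := ((hasDerivAt_exp_smul_const (𝕂 := ℝ) (a - b) s).mul_const
      (NormedSpace.exp (t • b))).hasDerivWithinAt (s := Set.Icc 0 t)
    exact ((ContinuousLinearMap.apply ℝ K u).hasFDerivAt.comp_hasDerivWithinAt s h)
  have hbound : ∀ s ∈ Set.Ico (0 : ℝ) t,
      ‖(NormedSpace.exp (s • (a - b)) * (a - b) * NormedSpace.exp (t • b)) u‖ ≤ ‖a u - b u‖ := by
    intro s hs
    have hce : Commute (a - b) (NormedSpace.exp (t • b)) := (hc.smul_right t).exp_right
    rw [mul_assoc, hce.eq, ← mul_assoc, key]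
    change ‖NormedSpace.exp (s • a) (NormedSpace.exp ((t - s) • b) (a u - b u))‖ ≤ _
    refine (ContinuousLinearMap.le_of_opNorm_le _ (ha s hs.1) _).trans ?_
    rw [one_mul]
    refine (ContinuousLinearMap.le_of_opNorm_le _ (hb (t - s) (by linarith [hs.2])) _).trans ?_
    rw [one_mul]
  have h := norm_image_sub_le_of_norm_deriv_le_segment' hder hbound t ⟨ht, le_rfl⟩
  rw [key, key] at h
  simp only [sub_self, zero_smul, NormedSpace.exp_zero, mul_one, sub_zero, one_mul] at h
  rw [mul_comm]
  exact h

end Contraction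

/-! ### The Hille–Yosida theorem for maximal accretive operators. -/

section HilleYosida

theorem tendsto_coe_nnreal_nhdsGT_zero :
    Tendsto (fun t : ℝ≥0 => (t : ℝ)) (𝓝[>] 0) (𝓝[>] 0) := by
  refine tendsto_nhdsWithin_iff.mpr ⟨?_, ?_⟩
  · exact (NNReal.continuous_coe.tendsto' 0 0 rfl).mono_left nhdsWithin_le_nhds
  · filter_upwards [self_mem_nhdsWithin] with t ht
    exact NNReal.coe_pos.mpr ht

variable {K : Type*} [NormedAddCommGroup K] [InnerProductSpace ℝ K]

/-- `G` is the graph of a densely defined accretive operator `A` such that `A + κ` is onto for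
every `κ ≥ 1`. -/
structure IsMaxAccretive (G : Submodule ℝ (K × K)) : Prop where
  accretive : ∀ p ∈ G, 0 ≤ inner ℝ p.2 p.1
  range : ∀ κ : ℝ, 1 ≤ κ → ∀ f : K, ∃ u, (u, f - κ • u) ∈ G
  dense : Dense (G.map (LinearMap.fst ℝ K K) : Set K)

namespace IsMaxAccretive

variable {G : Submodule ℝ (K × K)} (hG : IsMaxAccretive G)

include hG in
theorem norm_le {κ : ℝ} (hκ : 1 ≤ κ) {u f : K} (h : (u, f - κ • u) ∈ G) : ‖u‖ ≤ κ⁻¹ * ‖f‖ := by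
  have h1 := hG.accretive _ h
  simp only [inner_sub_left, real_inner_smul_left, real_inner_self_eq_norm_sq] at h1
  have h2 := real_inner_le_norm f u
  have h0 : 0 < κ := by linarith
  rw [inv_mul_eq_div, le_div_iff₀ h0]
  by_contra! hlt
  have hu : 0 < ‖u‖ := by
    by_contra! hle
    have : ‖u‖ = 0 := le_antisymm hle (norm_nonneg u)
    rw [this, zero_mul] at hlt
    linarith [norm_nonneg f]
  nlinarith [mul_lt_mul_of_pos_right hlt hu]

include hG in
theorem unique {κ : ℝ} (hκ : 1 ≤ κ) {u v f : K} (hu : (u, f - κ • u) ∈ G)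
    (hv : (v, f - κ • v) ∈ G) : u = v := by
  have h : (u - v, (0 : K) - κ • (u - v)) ∈ G := by
    convert! G.sub_mem hu hv using 1
    ext
    · rfl
    · simp only [Prod.snd_sub]; module
  have := hG.norm_le hκ h
  rw [norm_zero, mul_zero] at this
  exact sub_eq_zero.mp (norm_le_zero_iff.mp this)

/-- The resolvent `(A + κ)⁻¹`. -/
noncomputable def resolvent (κ : ℝ) (hκ : 1 ≤ κ) : K →L[ℝ] K :=
  LinearMap.mkContinuous
    { toFun := fun f => (hG.range κ hκ f).choose
      map_add' := fun f g => by
        refine hG.unique hκ (hG.range κ hκ (f + g)).choose_spec ?_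
        convert! G.add_mem (hG.range κ hκ f).choose_spec (hG.range κ hκ g).choose_spec using 1
        ext
        · rfl
        · simp only [Prod.snd_add]; module
      map_smul' := fun c f => by
        refine hG.unique hκ (hG.range κ hκ (c • f)).choose_spec ?_
        convert! G.smul_mem c (hG.range κ hκ f).choose_spec using 1
        ext
        · rfl
        · simp only [Prod.smul_snd, RingHom.id_apply]; module }
    κ⁻¹ fun f => hG.norm_le hκ (hG.range κ hκ f).choose_spec

theorem resolvent_mem {κ : ℝ} (hκ : 1 ≤ κ) (f : K) :
    (hG.resolvent κ hκ f, f - κ • hG.resolvent κ hκ f) ∈ G :=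
  (hG.range κ hκ f).choose_spec

theorem norm_resolvent_le {κ : ℝ} (hκ : 1 ≤ κ) : ‖hG.resolvent κ hκ‖ ≤ κ⁻¹ :=
  LinearMap.mkContinuous_norm_le _ (by positivity) _

theorem resolvent_eq {κ : ℝ} (hκ : 1 ≤ κ) {u f : K} (h : (u, f) ∈ G) :
    hG.resolvent κ hκ (f + κ • u) = u :=
  hG.unique hκ (hG.resolvent_mem hκ _) (by simpa using h)

theorem resolvent_identity {κ ν : ℝ} (hκ : 1 ≤ κ) (hν : 1 ≤ ν) (f : K) :
    (ν - κ) • hG.resolvent κ hκ (hG.resolvent ν hν f)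
      = hG.resolvent κ hκ f - hG.resolvent ν hν f := by
  rw [← map_smul]
  refine hG.unique hκ (hG.resolvent_mem hκ _) ?_
  convert! G.sub_mem (hG.resolvent_mem hκ f) (hG.resolvent_mem hν f) using 1
  ext
  · rfl
  · simp only [Prod.snd_sub]; module

theorem commute_resolvent {κ ν : ℝ} (hκ : 1 ≤ κ) (hν : 1 ≤ ν) :
    Commute (hG.resolvent κ hκ) (hG.resolvent ν hν) := by
  rcases eq_or_ne κ ν with rfl | hne
  · exact Commute.refl _
  ext f
  have h1 := hG.resolvent_identity hκ hν f
  have h2 := hG.resolvent_identity hν hκ f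
  have h3 : (ν - κ) • hG.resolvent κ hκ (hG.resolvent ν hν f)
      = (ν - κ) • hG.resolvent ν hν (hG.resolvent κ hκ f) := by
    rw [h1, ← neg_sub κ ν, neg_smul, h2, neg_sub]
  exact smul_right_injective K (sub_ne_zero.mpr hne.symm) h3

/-- The negative Yosida approximation `κ ^ 2 (A + κ)⁻¹ - κ`. -/
noncomputable def yosida (κ : ℝ) (hκ : 1 ≤ κ) : K →L[ℝ] K :=
  κ ^ 2 • hG.resolvent κ hκ - κ • (1 : K →L[ℝ] K)

theorem commute_yosida {κ ν : ℝ} (hκ : 1 ≤ κ) (hν : 1 ≤ ν) :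
    Commute (hG.yosida κ hκ) (hG.yosida ν hν) := by
  have h1 : ∀ (c : ℝ) (T : K →L[ℝ] K), Commute (c • (1 : K →L[ℝ] K)) T :=
    fun c T => (Commute.one_left T).smul_left c
  exact ((((hG.commute_resolvent hκ hν).smul_left _).smul_right _).sub_left (h1 _ _)).sub_right
    (h1 _ _).symm

theorem yosida_apply {κ : ℝ} (hκ : 1 ≤ κ) {u f : K} (h : (u, f) ∈ G) :
    hG.yosida κ hκ u = -(κ • hG.resolvent κ hκ f) := by
  have h1 := hG.resolvent_eq hκ h
  rw [map_add, map_smul] at h1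
  change κ ^ 2 • hG.resolvent κ hκ u - κ • u = _
  nth_rw 2 [← h1]
  module

/-- The maps `κ R_κ` are contractions, and on the domain `κ R_κ g - g = -R_κ (A g)` has norm at most
`‖A g‖ / κ`; density does the rest. -/
theorem tendsto_smul_resolvent (f : K) :
    Tendsto (fun n : ℕ => ((n : ℝ) + 1) • hG.resolvent (n + 1) (by simp) f) atTop (𝓝 f) := by
  have hnorm : ∀ (n : ℕ) (g : K), ‖((n : ℝ) + 1) • hG.resolvent (n + 1) (by simp) g‖ ≤ ‖g‖ := by
    intro n g
    have h1 : (1 : ℝ) ≤ n + 1 := by simp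
    rw [norm_smul, Real.norm_of_nonneg (by positivity)]
    have := ContinuousLinearMap.le_of_opNorm_le _ (hG.norm_resolvent_le h1) g
    calc ((n : ℝ) + 1) * ‖hG.resolvent (n + 1) h1 g‖ ≤ (n + 1) * ((n + 1 : ℝ)⁻¹ * ‖g‖) := by
          gcongr
      _ = ‖g‖ := by field_simp
  rw [Metric.tendsto_atTop]
  intro ε hε
  obtain ⟨g, hg, hfg⟩ := hG.dense.exists_dist_lt f (show 0 < ε / 3 by positivity)
  obtain ⟨⟨g', k⟩, hgk, rfl⟩ := hg
  obtain ⟨N, hN⟩ := exists_nat_gt (‖k‖ / (ε / 3))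
  refine ⟨N, fun n hn => ?_⟩
  have h1 : (1 : ℝ) ≤ n + 1 := by simp
  simp only [LinearMap.fst_apply] at hfg
  have e1 : ((n : ℝ) + 1) • hG.resolvent (n + 1) h1 g' - g' = -hG.resolvent (n + 1) h1 k := by
    have := hG.resolvent_eq h1 hgk
    rw [map_add, map_smul] at this
    nth_rw 2 [← this]
    abel
  have e2 : ‖hG.resolvent (n + 1) h1 k‖ < ε / 3 := by
    refine (ContinuousLinearMap.le_of_opNorm_le _ (hG.norm_resolvent_le h1) k).trans_lt ?_
    rw [inv_mul_eq_div, div_lt_iff₀ (by positivity)]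
    rw [div_lt_iff₀ (by positivity)] at hN
    have : (N : ℝ) ≤ n := by exact_mod_cast hn
    nlinarith
  have e3 := hnorm n (f - g')
  rw [dist_eq_norm] at hfg ⊢
  have e4 : ((n : ℝ) + 1) • hG.resolvent (n + 1) h1 f - f
      = ((n : ℝ) + 1) • hG.resolvent (n + 1) h1 (f - g')
        + (((n : ℝ) + 1) • hG.resolvent (n + 1) h1 g' - g') - (f - g') := by
    rw [map_sub]; module
  rw [e4, e1]
  calc _ ≤ ‖((n : ℝ) + 1) • hG.resolvent (n + 1) h1 (f - g') + -hG.resolvent (n + 1) h1 k‖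
        + ‖f - g'‖ := norm_sub_le _ _
    _ ≤ ‖((n : ℝ) + 1) • hG.resolvent (n + 1) h1 (f - g')‖ + ‖-hG.resolvent (n + 1) h1 k‖
        + ‖f - g'‖ := by gcongr; exact norm_add_le _ _
    _ < ε := by rw [norm_neg]; linarith

theorem tendsto_yosida {u f : K} (h : (u, f) ∈ G) :
    Tendsto (fun n : ℕ => hG.yosida (n + 1) (by simp) u) atTop (𝓝 (-f)) := by
  simp only [hG.yosida_apply _ h]
  exact (hG.tendsto_smul_resolvent f).neg

variable [CompleteSpace K]

/-- A positive scalar times a power series in the resolvent with nonnegative coefficients when `t ≥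
0`: this form yields both contractivity and invariance of cones. -/
theorem exp_smul_yosida {κ : ℝ} (hκ : 1 ≤ κ) (t : ℝ) :
    NormedSpace.exp (t • hG.yosida κ hκ) =
      Real.exp (-(t * κ)) • NormedSpace.exp ((t * κ ^ 2) • hG.resolvent κ hκ) := by
  have h : t • hG.yosida κ hκ
      = (-(t * κ)) • (1 : K →L[ℝ] K) + (t * κ ^ 2) • hG.resolvent κ hκ := by
    rw [yosida]; module
  rw [h, ((Commute.one_left _).smul_left _).exp_add_real, exp_smul_one_real, smul_mul_assoc,
    one_mul]

theorem norm_exp_smul_yosida_le {κ : ℝ} (hκ : 1 ≤ κ) {t : ℝ} (ht : 0 ≤ t) :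
    ‖NormedSpace.exp (t • hG.yosida κ hκ)‖ ≤ 1 := by
  -- On the trivial space the identity has norm `0`, so the norm bound for exponentials does not
  -- apply.
  rcases subsingleton_or_nontrivial K with hK | hK
  · rw [Subsingleton.elim (NormedSpace.exp (t • hG.yosida κ hκ)) 0, norm_zero]
    exact zero_le_one
  rw [hG.exp_smul_yosida hκ, norm_smul, Real.norm_of_nonneg (Real.exp_pos _).le]
  have h0 : 0 < κ := by linarith
  have h1 : ‖(t * κ ^ 2) • hG.resolvent κ hκ‖ ≤ t * κ := by
    rw [norm_smul, Real.norm_of_nonneg (by positivity)]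
    calc t * κ ^ 2 * ‖hG.resolvent κ hκ‖ ≤ t * κ ^ 2 * κ⁻¹ := by
          gcongr; exact hG.norm_resolvent_le hκ
      _ = t * κ := by field_simp
  calc Real.exp (-(t * κ)) * ‖NormedSpace.exp ((t * κ ^ 2) • hG.resolvent κ hκ)‖
      ≤ Real.exp (-(t * κ)) * Real.exp (t * κ) := by
        gcongr
        exact (norm_exp_le_exp_norm_of_normOneClass _).trans (Real.exp_le_exp.mpr h1)
    _ = 1 := by rw [← Real.exp_add]; simp

theorem exp_smul_yosida_mem {κ : ℝ} (hκ : 1 ≤ κ) {t : ℝ} (ht : 0 ≤ t) {C : PointedCone ℝ K}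
    (hC : IsClosed (C : Set K)) (hR : ∀ f ∈ C, hG.resolvent κ hκ f ∈ C) {f : K} (hf : f ∈ C) :
    NormedSpace.exp (t • hG.yosida κ hκ) f ∈ C := by
  have hsmul : ∀ c : ℝ, 0 ≤ c → ∀ g ∈ C, c • g ∈ C :=
    fun c hc g hg => C.smul_mem hc hg
  rw [hG.exp_smul_yosida hκ]
  refine hsmul _ (Real.exp_pos _).le _ ?_
  have hs := NormedSpace.exp_series_hasSum_exp' (𝕂 := ℝ) ((t * κ ^ 2) • hG.resolvent κ hκ)
  have hs' := (ContinuousLinearMap.apply ℝ K f).hasSum hs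
  refine hC.mem_of_tendsto hs' (Eventually.of_forall fun s => C.sum_mem fun n _ => ?_)
  change (n.factorial : ℝ)⁻¹ • (((t * κ ^ 2) • hG.resolvent κ hκ) ^ n) f ∈ C
  refine hsmul _ (by positivity) _ ?_
  clear * - hsmul hR hf ht
  induction n with
  | zero => simpa using hf
  | succ n ih =>
    rw [pow_succ']
    exact hsmul _ (by positivity) _ (hR _ ih)

/-- On the domain, `norm_exp_smul_apply_sub_le` reduces this to convergence of the Yosida
approximations; contractivity extends it to the closure. -/
theorem cauchySeq_exp_yosida {t : ℝ} (ht : 0 ≤ t) (f : K) :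
    CauchySeq fun n : ℕ => NormedSpace.exp (t • hG.yosida (n + 1) (by simp)) f := by
  have h1 : ∀ n : ℕ, (1 : ℝ) ≤ n + 1 := by simp
  rw [Metric.cauchySeq_iff]
  intro ε hε
  obtain ⟨_, ⟨⟨g, k⟩, hgk, rfl⟩, hfg⟩ := hG.dense.exists_dist_lt f (show 0 < ε / 3 by positivity)
  have hc := (hG.tendsto_yosida hgk).cauchySeq
  rw [Metric.cauchySeq_iff] at hc
  obtain ⟨N, hN⟩ := hc (ε / 3 / (t + 1)) (by positivity)
  refine ⟨N, fun i hi j hj => ?_⟩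
  simp only [LinearMap.fst_apply] at hfg
  have e1 : ∀ n : ℕ, ‖NormedSpace.exp (t • hG.yosida (n + 1) (h1 n)) (f - g)‖ ≤ ‖f - g‖ := by
    intro n
    simpa using ContinuousLinearMap.le_of_opNorm_le _ (hG.norm_exp_smul_yosida_le (h1 n) ht) (f - g)
  have e2 := norm_exp_smul_apply_sub_le (hG.commute_yosida (h1 i) (h1 j))
    (fun s hs => hG.norm_exp_smul_yosida_le _ hs) (fun s hs => hG.norm_exp_smul_yosida_le _ hs) ht g
  have e3 := hN i hi j hj
  rw [dist_eq_norm] at hfg e3 ⊢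
  rw [lt_div_iff₀ (by positivity)] at e3
  have e4 : t * ‖hG.yosida (i + 1) (h1 i) g - hG.yosida (j + 1) (h1 j) g‖ < ε / 3 := by
    nlinarith [norm_nonneg (hG.yosida (i + 1) (h1 i) g - hG.yosida (j + 1) (h1 j) g)]
  have e5 : NormedSpace.exp (t • hG.yosida (i + 1) (h1 i)) f
        - NormedSpace.exp (t • hG.yosida (j + 1) (h1 j)) f
      = NormedSpace.exp (t • hG.yosida (i + 1) (h1 i)) (f - g)
        + (NormedSpace.exp (t • hG.yosida (i + 1) (h1 i)) g
          - NormedSpace.exp (t • hG.yosida (j + 1) (h1 j)) g)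
        - NormedSpace.exp (t • hG.yosida (j + 1) (h1 j)) (f - g) := by
    rw [map_sub, map_sub]; abel
  rw [e5]
  calc _ ≤ _ := norm_sub_le _ _
    _ ≤ ‖NormedSpace.exp (t • hG.yosida (i + 1) (h1 i)) (f - g)‖
        + ‖NormedSpace.exp (t • hG.yosida (i + 1) (h1 i)) g
          - NormedSpace.exp (t • hG.yosida (j + 1) (h1 j)) g‖
        + ‖NormedSpace.exp (t • hG.yosida (j + 1) (h1 j)) (f - g)‖ := by
      gcongr; exact norm_add_le _ _
    _ < ε := by linarith [e1 i, e1 j]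

/-- The contraction semigroup generated by `-A`, as the limit of the exponentials of the Yosida
approximations. -/
noncomputable def semigroup (t : ℝ≥0) : K →L[ℝ] K :=
  continuousLinearMapOfTendsto (l := atTop)
    (fun n : ℕ => NormedSpace.exp ((t : ℝ) • hG.yosida (n + 1) (by simp)))
    (f := fun f => (cauchySeq_tendsto_of_complete (hG.cauchySeq_exp_yosida t.2 f)).choose)
    (tendsto_pi_nhds.mpr fun f =>
      (cauchySeq_tendsto_of_complete (hG.cauchySeq_exp_yosida t.2 f)).choose_spec)

theorem tendsto_exp_yosida (t : ℝ≥0) (f : K) :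
    Tendsto (fun n : ℕ => NormedSpace.exp ((t : ℝ) • hG.yosida (n + 1) (by simp)) f) atTop
      (𝓝 (hG.semigroup t f)) :=
  (cauchySeq_tendsto_of_complete (hG.cauchySeq_exp_yosida t.2 f)).choose_spec

theorem norm_semigroup_le (t : ℝ≥0) (f : K) : ‖hG.semigroup t f‖ ≤ ‖f‖ := by
  refine le_of_tendsto (hG.tendsto_exp_yosida t f).norm (Eventually.of_forall fun n => ?_)
  simpa using ContinuousLinearMap.le_of_opNorm_le _
    (hG.norm_exp_smul_yosida_le (show (1 : ℝ) ≤ n + 1 by simp) t.2) f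

theorem semigroup_mem {C : PointedCone ℝ K} (hC : IsClosed (C : Set K))
    (hR : ∀ (κ : ℝ) (hκ : 1 ≤ κ), ∀ f ∈ C, hG.resolvent κ hκ f ∈ C) (t : ℝ≥0) {f : K}
    (hf : f ∈ C) : hG.semigroup t f ∈ C :=
  hC.mem_of_tendsto (hG.tendsto_exp_yosida t f)
    (Eventually.of_forall fun _ => hG.exp_smul_yosida_mem _ t.2 hC (hR _ _) hf)

theorem semigroup_zero : hG.semigroup 0 = ContinuousLinearMap.id ℝ K := by
  ext f
  refine tendsto_nhds_unique (hG.tendsto_exp_yosida 0 f) ?_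
  simp

theorem semigroup_add (s t : ℝ≥0) :
    hG.semigroup (s + t) = (hG.semigroup s).comp (hG.semigroup t) := by
  ext f
  refine tendsto_nhds_unique (hG.tendsto_exp_yosida (s + t) f) ?_
  have h1 : ∀ n : ℕ, (1 : ℝ) ≤ n + 1 := by simp
  have h2 : ∀ n : ℕ, NormedSpace.exp (((s + t : ℝ≥0) : ℝ) • hG.yosida (n + 1) (h1 n)) f
      = NormedSpace.exp ((s : ℝ) • hG.yosida (n + 1) (h1 n))
          (NormedSpace.exp ((t : ℝ) • hG.yosida (n + 1) (h1 n)) f - hG.semigroup t f)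
        + NormedSpace.exp ((s : ℝ) • hG.yosida (n + 1) (h1 n)) (hG.semigroup t f) := by
    intro n
    rw [NNReal.coe_add, add_smul,
      (((Commute.refl (hG.yosida (n + 1) (h1 n))).smul_left _).smul_right _).exp_add_real, map_sub]
    simp
  have h3 : Tendsto (fun n : ℕ => NormedSpace.exp ((s : ℝ) • hG.yosida (n + 1) (h1 n))
      (NormedSpace.exp ((t : ℝ) • hG.yosida (n + 1) (h1 n)) f - hG.semigroup t f)) atTop (𝓝 0) := by
    have h4 := ((hG.tendsto_exp_yosida t f).sub_const (hG.semigroup t f)).norm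
    rw [sub_self, norm_zero] at h4
    refine squeeze_zero_norm (fun n => ?_) h4
    refine (ContinuousLinearMap.le_of_opNorm_le _
      (hG.norm_exp_smul_yosida_le (h1 n) s.coe_nonneg) _).trans_eq (one_mul _)
  simp only [h2]
  have := h3.add (hG.tendsto_exp_yosida s (hG.semigroup t f))
  rwa [zero_add] at this

/-- The error is linear in `t`, so it stays small after division by `t`; this transfers the
derivative at `0` from a fixed Yosida approximation to the semigroup. -/
theorem norm_semigroup_sub_exp_le {u f : K} (h : (u, f) ∈ G) (t : ℝ≥0) {κ : ℝ} (hκ : 1 ≤ κ) :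
    ‖hG.semigroup t u - NormedSpace.exp ((t : ℝ) • hG.yosida κ hκ) u‖
      ≤ t * ‖-f - hG.yosida κ hκ u‖ := by
  refine le_of_tendsto_of_tendsto ((hG.tendsto_exp_yosida t u).sub_const _).norm
    ((((hG.tendsto_yosida h).sub_const (hG.yosida κ hκ u)).norm).const_mul (t : ℝ))
    (Eventually.of_forall fun n => ?_)
  exact norm_exp_smul_apply_sub_le (hG.commute_yosida _ _)
    (fun s hs => hG.norm_exp_smul_yosida_le _ hs) (fun s hs => hG.norm_exp_smul_yosida_le _ hs) t.2 u

theorem norm_semigroup_sub_self_le {u f : K} (h : (u, f) ∈ G) (t : ℝ≥0) :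
    ‖hG.semigroup t u - u‖ ≤ t * ‖f‖ := by
  -- The identity is the semigroup generated by `0`, so the comparison estimate applies.
  have h0 : ∀ s : ℝ, 0 ≤ s → ‖NormedSpace.exp (s • (0 : K →L[ℝ] K))‖ ≤ 1 := by
    intro s _
    rw [smul_zero, NormedSpace.exp_zero]
    exact ContinuousLinearMap.norm_id_le
  refine le_of_tendsto_of_tendsto ((hG.tendsto_exp_yosida t u).sub_const u).norm
    ((hG.tendsto_yosida h).norm.const_mul (t : ℝ)) (Eventually.of_forall fun n => ?_) |>.trans_eq ?_
  · have := norm_exp_smul_apply_sub_le (Commute.zero_right (hG.yosida (n + 1) (by simp)))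
      (fun s hs => hG.norm_exp_smul_yosida_le _ hs) h0 t.2 u
    simpa using this
  · rw [norm_neg]

theorem continuous_semigroup (f : K) : Continuous fun t => hG.semigroup t f := by
  have hdom : ∀ p ∈ G, Continuous fun t => hG.semigroup t p.1 := by
    rintro ⟨u, g⟩ h
    have hlip : ∀ s t : ℝ≥0, s ≤ t →
        ‖hG.semigroup t u - hG.semigroup s u‖ ≤ ‖g‖ * ((t : ℝ) - s) := by
      intro s t hst
      obtain ⟨r, rfl⟩ := exists_add_of_le hst
      rw [hG.semigroup_add, ContinuousLinearMap.comp_apply, ← map_sub, NNReal.coe_add,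
        add_sub_cancel_left, mul_comm]
      exact (hG.norm_semigroup_le s _).trans (hG.norm_semigroup_sub_self_le h r)
    refine (LipschitzWith.of_dist_le_mul (K := ‖g‖₊) fun s t => ?_).continuous
    rw [coe_nnnorm, NNReal.dist_eq]
    rcases le_total s t with hst | hst
    · rw [dist_comm, dist_eq_norm, abs_sub_comm, abs_of_nonneg (sub_nonneg.mpr (by exact_mod_cast hst))]
      exact hlip s t hst
    · rw [dist_eq_norm, abs_of_nonneg (sub_nonneg.mpr (by exact_mod_cast hst))]
      exact hlip t s hst
  refine continuous_of_uniform_approx_of_continuous fun U hU => ?_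
  obtain ⟨ε, hε, hεU⟩ := Metric.mem_uniformity_dist.mp hU
  obtain ⟨_, ⟨p, hp, rfl⟩, hfg⟩ := hG.dense.exists_dist_lt f hε
  refine ⟨_, hdom p hp, fun t => hεU ?_⟩
  rw [dist_eq_norm, ← map_sub]
  rw [dist_eq_norm] at hfg
  exact (hG.norm_semigroup_le t _).trans_lt hfg

theorem tendsto_of_mem {u f : K} (h : (u, f) ∈ G) :
    Tendsto (fun t : ℝ≥0 => (t : ℝ)⁻¹ • (u - hG.semigroup t u)) (𝓝[>] 0) (𝓝 f) := by
  rw [Metric.tendsto_nhds]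
  intro ε hε
  obtain ⟨n, hn⟩ := (Metric.tendsto_nhds.mp (hG.tendsto_yosida h) (ε / 3) (by positivity)).exists
  have h1 : (1 : ℝ) ≤ n + 1 := by simp
  set B := hG.yosida (n + 1) h1 with hB
  have hd : HasDerivAt (fun s : ℝ => NormedSpace.exp (s • B) u) (B u) 0 := by
    have := hasDerivAt_exp_smul_const (𝕂 := ℝ) B 0
    rw [zero_smul, NormedSpace.exp_zero, one_mul] at this
    exact ((ContinuousLinearMap.apply ℝ K u).hasFDerivAt.comp_hasDerivAt (0 : ℝ) this)
  have hs : Tendsto (fun s : ℝ => s⁻¹ • (NormedSpace.exp (s • B) u - u)) (𝓝[>] 0) (𝓝 (B u)) := by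
    have := hd.tendsto_slope_zero_right
    simpa using this
  filter_upwards [Metric.tendsto_nhds.mp (hs.comp tendsto_coe_nnreal_nhdsGT_zero) (ε / 3) (by positivity),
    self_mem_nhdsWithin] with t ht ht0
  have ht0' : (0 : ℝ) < t := NNReal.coe_pos.mpr ht0
  have e1 := hG.norm_semigroup_sub_exp_le h t h1
  rw [dist_eq_norm] at hn ht ⊢
  simp only [Function.comp_apply] at ht
  rw [← hB] at e1
  have e2 : ‖(t : ℝ)⁻¹ • (hG.semigroup t u - NormedSpace.exp ((t : ℝ) • B) u)‖ ≤ ‖B u - -f‖ := by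
    rw [norm_smul, norm_inv, Real.norm_of_nonneg ht0'.le, inv_mul_le_iff₀ ht0', norm_sub_rev (B u)]
    exact e1
  have e3 : (t : ℝ)⁻¹ • (u - hG.semigroup t u) - f
      = -((t : ℝ)⁻¹ • (hG.semigroup t u - NormedSpace.exp ((t : ℝ) • B) u)
        + ((t : ℝ)⁻¹ • (NormedSpace.exp ((t : ℝ) • B) u - u) - B u) + (B u - -f)) := by module
  rw [e3, norm_neg]
  calc _ ≤ _ := norm_add₃_le
    _ < ε := by linarith

/-- Maximality: contractivity makes the negative of the generator an accretive extension of `A`. If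
`w` solves `A w + w = f + u`, accretivity applied to `u - w` gives `-‖u - w‖² ≥ 0`. -/
theorem mem_of_tendsto {u f : K}
    (h : Tendsto (fun t : ℝ≥0 => (t : ℝ)⁻¹ • (u - hG.semigroup t u)) (𝓝[>] 0) (𝓝 f)) :
    (u, f) ∈ G := by
  obtain ⟨w, hw⟩ := hG.range 1 le_rfl (f + u)
  rw [one_smul] at hw
  have h1 := h.sub (hG.tendsto_of_mem hw)
  have h2 : 0 ≤ inner ℝ (f - (f + u - w)) (u - w) := by
    refine ge_of_tendsto (h1.inner tendsto_const_nhds)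
      (Eventually.of_forall fun t => ?_)
    have e : (t : ℝ)⁻¹ • (u - hG.semigroup t u) - (t : ℝ)⁻¹ • (w - hG.semigroup t w)
        = (t : ℝ)⁻¹ • ((u - w) - hG.semigroup t (u - w)) := by rw [map_sub]; module
    rw [e, real_inner_smul_left, inner_sub_left, real_inner_self_eq_norm_sq]
    have e1 := real_inner_le_norm (hG.semigroup t (u - w)) (u - w)
    have e2 := hG.norm_semigroup_le t (u - w)
    have : 0 ≤ ‖u - w‖ ^ 2 - inner ℝ (hG.semigroup t (u - w)) (u - w) := by
      nlinarith [norm_nonneg (u - w)]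
    positivity
  have h3 : f - (f + u - w) = -(u - w) := by abel
  rw [h3, inner_neg_left, real_inner_self_eq_norm_sq] at h2
  have h4 : u - w = 0 := by
    rw [← norm_eq_zero]
    nlinarith [norm_nonneg (u - w)]
  obtain rfl := sub_eq_zero.mp h4
  simpa using hw

end IsMaxAccretive

end HilleYosida

/-! ### Rescaling by an exponential, and uniqueness of the semigroup. -/

section SemigroupOf

variable {K : Type*} [NormedAddCommGroup K] [InnerProductSpace ℝ K]

theorem tendsto_toNNReal_sub_nhdsGT (x : ℝ) :
    Tendsto (fun z : ℝ => (z - x).toNNReal) (𝓝[>] x) (𝓝[>] 0) := by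
  refine tendsto_nhdsWithin_iff.mpr ⟨?_, ?_⟩
  · have : Continuous fun z : ℝ => (z - x).toNNReal := by fun_prop
    exact (this.tendsto' x 0 (by simp)).mono_left nhdsWithin_le_nhds
  · filter_upwards [self_mem_nhdsWithin] with z hz
    exact Real.toNNReal_pos.mpr (sub_pos.mpr hz)

theorem tendsto_inv_mul_one_sub_exp (c : ℝ) :
    Tendsto (fun t : ℝ≥0 => (t : ℝ)⁻¹ * (1 - Real.exp (c * t))) (𝓝[>] 0) (𝓝 (-c)) := by
  have h : HasDerivAt (fun s : ℝ => Real.exp (c * s)) c 0 := by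
    have := ((hasDerivAt_id (0 : ℝ)).const_mul c).exp
    simpa using this
  have h2 := (h.tendsto_slope_zero_right.comp tendsto_coe_nnreal_nhdsGT_zero).neg
  refine h2.congr fun t => ?_
  simp only [Function.comp_apply, zero_add, mul_zero, Real.exp_zero, smul_eq_mul]
  ring

theorem IsMaxAccretive.isSemigroupOf [CompleteSpace K] {L : K →ₗ.[ℝ] K} {c : ℝ}
    {G : Submodule ℝ (K × K)} (hG : IsMaxAccretive G)
    (h : ∀ u f : K, (u, f) ∈ L.graph ↔ (u, f + c • u) ∈ G) :
    IsSemigroupOf L fun t => Real.exp (c * t) • hG.semigroup t where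
  map_zero := by
    rw [hG.semigroup_zero, NNReal.coe_zero, mul_zero, Real.exp_zero, one_smul]
  map_add s t := by
    rw [hG.semigroup_add, NNReal.coe_add, mul_add, Real.exp_add]
    ext u
    simp only [smul_apply, ContinuousLinearMap.comp_apply, map_smul, mul_smul]
    exact smul_comm _ _ _
  continuous u := by
    have h1 : Continuous fun t : ℝ≥0 => Real.exp (c * t) := by fun_prop
    exact h1.smul (hG.continuous_semigroup u)
  generator u f := by
    have h1 : Tendsto (fun t : ℝ≥0 => Real.exp (c * t)) (𝓝[>] 0) (𝓝 1) := by
      have h1 : Continuous fun t : ℝ≥0 => Real.exp (c * t) := by fun_prop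
      exact (h1.tendsto' 0 1 (by simp)).mono_left nhdsWithin_le_nhds
    have h2 := tendsto_inv_mul_one_sub_exp c
    rw [h]
    constructor
    · intro hu
      have h3 := (h1.smul (hG.tendsto_of_mem hu)).add (h2.smul_const u)
      rw [one_smul, neg_smul, add_neg_cancel_right] at h3
      refine h3.congr fun t => ?_
      change _ = (t : ℝ)⁻¹ • (u - Real.exp (c * t) • hG.semigroup t u)
      module
    · intro hu
      refine hG.mem_of_tendsto ?_
      have h3 := (h1.inv₀ one_ne_zero).smul (hu.sub (h2.smul_const u))
      rw [inv_one, one_smul, neg_smul, sub_neg_eq_add] at h3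
      refine h3.congr fun t => ?_
      change (Real.exp (c * t))⁻¹ • ((t : ℝ)⁻¹ • (u - Real.exp (c * t) • hG.semigroup t u)
        - ((t : ℝ)⁻¹ * (1 - Real.exp (c * t))) • u) = _
      have e : (t : ℝ)⁻¹ • (u - Real.exp (c * t) • hG.semigroup t u)
          - ((t : ℝ)⁻¹ * (1 - Real.exp (c * t))) • u
          = Real.exp (c * t) • ((t : ℝ)⁻¹ • (u - hG.semigroup t u)) := by module
      rw [e, inv_smul_smul₀ (Real.exp_pos _).ne']

namespace IsSemigroupOf

variable {L : K →ₗ.[ℝ] K} {T S : ℝ≥0 → K →L[ℝ] K}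

theorem tendsto_right (hT : IsSemigroupOf L T) {u f : K} (h : (u, f) ∈ L.graph) (t : ℝ≥0) :
    Tendsto (fun s : ℝ≥0 => (s : ℝ)⁻¹ • (T t u - T (t + s) u)) (𝓝[>] 0) (𝓝 (T t f)) := by
  have h1 := ((T t).continuous.tendsto f).comp ((hT.generator u f).mp h)
  refine h1.congr fun s => ?_
  rw [hT.map_add]
  simp

theorem mem_graph (hT : IsSemigroupOf L T) {u f : K} (h : (u, f) ∈ L.graph) (t : ℝ≥0) :
    (T t u, T t f) ∈ L.graph := by
  refine (hT.generator _ _).mpr ((hT.tendsto_right h t).congr fun s => ?_)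
  rw [add_comm, hT.map_add, ContinuousLinearMap.comp_apply]

theorem hasDerivWithinAt (hT : IsSemigroupOf L T) {u f : K} (h : (u, f) ∈ L.graph) {x : ℝ}
    (hx : 0 ≤ x) :
    HasDerivWithinAt (fun z : ℝ => T z.toNNReal u) (-T x.toNNReal f) (Set.Ici x) x := by
  rw [hasDerivWithinAt_iff_tendsto_slope, Set.Ici_sdiff_left]
  have h1 := ((hT.tendsto_right h x.toNNReal).comp (tendsto_toNNReal_sub_nhdsGT x)).neg
  refine h1.congr' ?_
  filter_upwards [self_mem_nhdsWithin] with z hz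
  have hz' : 0 ≤ z - x := sub_nonneg.mpr (le_of_lt hz)
  rw [Function.comp_apply, ← Real.toNNReal_add hx hz', Real.coe_toNNReal _ hz',
    add_sub_cancel, slope_def_module]
  module

/-- For `u` in the domain, `w = T u - S u` satisfies `d/dt ‖w‖² = -2 (L w, w) ≤ 2 c ‖w‖²` and `w(0)
= 0`. The definition of the generator gives right derivatives only, which suffice for Gronwall. -/
theorem unique (hT : IsSemigroupOf L T) (hS : IsSemigroupOf L S) (hL : Dense (L.domain : Set K))
    {c : ℝ} (hc : ∀ p ∈ L.graph, -c * ‖p.1‖ ^ 2 ≤ inner ℝ p.2 p.1) : T = S := by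
  have key : ∀ u f : K, (u, f) ∈ L.graph → ∀ t, T t u = S t u := by
    intro u f h t
    set w : ℝ → K := fun z => T z.toNNReal u - S z.toNNReal u with hw
    have hd : ∀ x : ℝ, 0 ≤ x → HasDerivWithinAt (fun z => ‖w z‖ ^ 2)
        (2 * inner ℝ (w x) (-T x.toNNReal f - -S x.toNNReal f)) (Set.Ici x) x :=
      fun x hx => ((hT.hasDerivWithinAt h hx).sub (hS.hasDerivWithinAt h hx)).norm_sq
    have hcont : Continuous fun z => ‖w z‖ ^ 2 := by
      have h1 := (hT.continuous u).comp continuous_real_toNNReal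
      have h2 := (hS.continuous u).comp continuous_real_toNNReal
      exact (h1.sub h2).norm.pow 2
    have hg := le_gronwallBound_of_liminf_deriv_right_le (a := 0) (b := t) (δ := 0) (ε := 0)
      (K := 2 * c) hcont.continuousOn
      (fun x hx r hr => ((hd x hx.1).liminf_right_slope_le hr).mono fun z hz => by
        simpa [slope_def_field, inv_mul_eq_div] using hz)
      (by simp [hw, hT.map_zero, hS.map_zero])
      (fun x hx => by
        have hm := L.graph.sub_mem (hT.mem_graph h x.toNNReal) (hS.mem_graph h x.toNNReal)
        have := hc _ hm
        simp only [Prod.fst_sub, Prod.snd_sub] at this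
        have e : -T x.toNNReal f - -S x.toNNReal f = -(T x.toNNReal f - S x.toNNReal f) := by abel
        rw [e, inner_neg_right, real_inner_comm]
        simp only [hw]
        linarith) t ⟨t.2, le_rfl⟩
    rw [gronwallBound_ε0_δ0] at hg
    have h0 : ‖w t‖ = 0 := by nlinarith [norm_nonneg (w t)]
    have := norm_eq_zero.mp h0
    simp only [hw, Real.toNNReal_coe] at this
    exact sub_eq_zero.mp this
  funext t
  ext v
  refine hL.induction (P := fun v => T t v = S t v) (fun u hu => ?_) ?_ v
  · exact key u (L ⟨u, hu⟩) (L.mem_graph ⟨u, hu⟩) t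
  · exact isClosed_eq (T t).continuous (S t).continuous

end IsSemigroupOf

end SemigroupOf

/-! ### Riesz representation and equivalent inner products. -/

section HilbertInner

variable {V : Type*} [AddCommGroup V] [Module ℝ V] {B : LinearMap.BilinForm ℝ V}

/-- Riesz representation. -/
theorem IsHilbertInner.exists_representer (hB : IsHilbertInner B) (l : V →ₗ[ℝ] ℝ) {C : ℝ}
    (hl : ∀ v, l v ^ 2 ≤ C * B v v) : ∃ w, ∀ v, B w v = l v := by
  let core : InnerProductSpace.Core ℝ V :=
    { inner := fun u v => B u v
      conj_inner_symm := fun u v => hB.symm v u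
      re_inner_nonneg := fun u => by
        rcases eq_or_ne u 0 with rfl | hu
        · simp
        · exact (hB.pos u hu).le
      add_left := fun u v w => by simp
      smul_left := fun u v r => by simp
      definite := fun u hu => by
        by_contra h
        exact (hB.pos u h).ne' hu }
  let _ : NormedAddCommGroup V := core.toNormedAddCommGroup
  let _ : InnerProductSpace ℝ V := InnerProductSpace.ofCore core.toCore
  have hnorm : ∀ u : V, ‖u‖ ^ 2 = B u u := fun u => (real_inner_self_eq_norm_sq u).symm
  have : CompleteSpace V := by
    refine Metric.complete_of_cauchySeq_tendsto fun u hu => ?_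
    obtain ⟨w, hw⟩ := hB.complete u fun ε hε => by
      obtain ⟨N, hN⟩ := Metric.cauchySeq_iff.mp hu (Real.sqrt ε) (Real.sqrt_pos.mpr hε)
      refine ⟨N, fun i hi j hj => ?_⟩
      have h := hN i hi j hj
      rw [dist_eq_norm] at h
      rw [← hnorm]
      exact (Real.lt_sqrt (norm_nonneg _)).mp h
    refine ⟨w, tendsto_iff_norm_sub_tendsto_zero.mpr ?_⟩
    simp only [← hnorm] at hw
    have h := hw.sqrt
    simpa only [Real.sqrt_zero, Real.sqrt_sq (norm_nonneg _)] using h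
  have hbound : ∀ v : V, ‖l v‖ ≤ Real.sqrt C * ‖v‖ := by
    intro v
    have h := hl v
    rw [← hnorm] at h
    -- No sign of `C` is assumed; a negative `C` forces `l = 0`.
    rcases le_or_gt 0 C with hC | hC
    · refine (sq_le_sq₀ (norm_nonneg _) (by positivity)).mp ?_
      rw [mul_pow, Real.sq_sqrt hC, Real.norm_eq_abs, sq_abs]
      exact h
    · have h2 : l v ^ 2 = 0 := by nlinarith [sq_nonneg (l v), sq_nonneg ‖v‖]
      rw [pow_eq_zero_iff two_ne_zero] at h2
      rw [h2, norm_zero]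
      positivity
  have hdual : ∀ v, inner ℝ ((InnerProductSpace.toDual ℝ V).symm (l.mkContinuous _ hbound)) v
      = l v := fun v => InnerProductSpace.toDual_symm_apply
  exact ⟨_, hdual⟩

theorem IsHilbertInner.of_equivalent (hB : IsHilbertInner B) {B' : LinearMap.BilinForm ℝ V}
    (hsymm : ∀ u v, B' u v = B' v u) {M : ℝ} (hle : ∀ u, B u u ≤ B' u u)
    (hge : ∀ u, B' u u ≤ M * B u u) : IsHilbertInner B' where
  symm := hsymm
  pos u hu := (hB.pos u hu).trans_le (hle u)
  complete u hu := by
    obtain ⟨w, hw⟩ := hB.complete u fun ε hε => by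
      obtain ⟨N, hN⟩ := hu ε hε
      exact ⟨N, fun i hi j hj => (hle _).trans_lt (hN i hi j hj)⟩
    have hnn : ∀ v, 0 ≤ B' v v := by
      intro v
      rcases eq_or_ne v 0 with rfl | hv
      · simp
      · exact ((hB.pos v hv).trans_le (hle v)).le
    have h := hw.const_mul M
    rw [mul_zero] at h
    exact ⟨w, squeeze_zero (fun n => hnn _) (fun n => hge _) h⟩

end HilbertInner

/-! ### Operators of forms: resolvents and lower bounds. -/

namespace SymmForm

section Operator

variable {H : Type*} [NormedAddCommGroup H] [InnerProductSpace ℝ H] {Q : SymmForm H}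

theorem mem_graph_operator (hd : Q.IsDenselyDefined) {u f : H} :
    (u, f) ∈ Q.operator.graph ↔
      ∃ hu : u ∈ Q.domain, ∀ v : Q.domain, Q.bilin ⟨u, hu⟩ v = inner ℝ f (v : H) := by
  rw [graph_operator Q hd]
  rfl

theorem mem_eigenvalues (hd : Q.IsDenselyDefined) {e : ℝ} {u : Q.domain} (hu : u ≠ 0)
    (h : ∀ v, Q.shift e u v = 0) : e ∈ eigenvalues Q.operator := by
  have hm : ((u : H), e • (u : H)) ∈ Q.operator.graph := by
    refine (mem_graph_operator hd).mpr ⟨u.2, fun v => ?_⟩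
    have := h v
    rw [shift_apply] at this
    rw [real_inner_smul_left]
    exact sub_eq_zero.mp this
  obtain ⟨y, hy, hy'⟩ := (LinearPMap.mem_graph_iff _).mp hm
  simp only at hy hy'
  refine ⟨y, ?_, by rw [hy', hy]⟩
  rw [hy]
  simpa using hu

/-- Off the eigenvalues, an operator with compact resolvent has a bounded resolvent. -/
theorem exists_bounded_resolvent [CompleteSpace H] (hd : Q.IsDenselyDefined)
    (hc : HasCompactResolvent Q.operator) {e : ℝ} (he : e ∉ eigenvalues Q.operator) :
    ∃ S : H →L[ℝ] H, ∀ f, ∃ hu : S f ∈ Q.domain, ∀ v : Q.domain,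
      Q.shift e ⟨S f, hu⟩ v = inner ℝ f (v : H) := by
  obtain ⟨z, R, hR, hR1, -⟩ := hc
  have hRg : ∀ f, ∃ hu : R f ∈ Q.domain, ∀ v : Q.domain,
      Q.bilin ⟨R f, hu⟩ v = inner ℝ (f + z • R f) (v : H) := by
    intro f
    obtain ⟨u, hu, huf⟩ := hR1 f
    have hm := Q.operator.mem_graph u
    rw [hu, sub_eq_iff_eq_add.mp huf, hu] at hm
    exact (mem_graph_operator hd).mp hm
  rcases eq_or_ne e z with rfl | hez
  · refine ⟨R, fun f => ?_⟩
    obtain ⟨hu, h⟩ := hRg f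
    refine ⟨hu, fun v => ?_⟩
    rw [shift_apply, h, inner_add_left, real_inner_smul_left]
    simp
  have hez' : e - z ≠ 0 := sub_ne_zero.mpr hez
  -- Since `(L - e) R = 1 - (e - z) R`, the number `e` is regular unless `(e - z)⁻¹` is an
  -- eigenvalue of the compact `R`, whose eigenvectors would be eigenvectors of `L` for `e`.
  rcases hR.hasEigenvalue_or_mem_resolventSet (inv_ne_zero hez') with hev | hres
  · obtain ⟨f, hf⟩ := hev.exists_hasEigenvector
    have hRf : R f = (e - z)⁻¹ • f := hf.apply_eq_smul
    have hf0 : R f ≠ 0 := by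
      rw [hRf]
      exact smul_ne_zero (inv_ne_zero hez') hf.2
    have hfe : f = (e - z) • R f := by rw [hRf, smul_inv_smul₀ hez']
    obtain ⟨hu, h⟩ := hRg f
    refine absurd (mem_eigenvalues hd (u := ⟨R f, hu⟩) (fun h0 => hf0 (congrArg Subtype.val h0))
      fun v => ?_) he
    rw [shift_apply, h]
    nth_rw 1 [hfe]
    rw [inner_add_left, real_inner_smul_left, real_inner_smul_left]
    ring
  · obtain ⟨S, hS⟩ := (show IsUnit _ from hres).exists_right_inv
    refine ⟨(e - z)⁻¹ • R ∘L S, fun f => ?_⟩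
    obtain ⟨hu, h⟩ := hRg ((e - z)⁻¹ • S f)
    have hSf : (e - z)⁻¹ • S f - R (S f) = f := by
      have := DFunLike.congr_fun hS f
      simpa [Algebra.algebraMap_eq_smul_one] using this
    have hval : ((e - z)⁻¹ • R ∘L S) f = R ((e - z)⁻¹ • S f) := by simp
    simp only [hval]
    refine ⟨hu, fun v => ?_⟩
    rw [shift_apply, h, ← real_inner_smul_left, ← inner_sub_left]
    congr 1
    change (e - z)⁻¹ • S f + z • R ((e - z)⁻¹ • S f) - e • R ((e - z)⁻¹ • S f) = f
    rw [map_smul]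
    nth_rw 4 [← hSf]
    have : e • (e - z)⁻¹ • R (S f) - z • (e - z)⁻¹ • R (S f) = R (S f) := by
      rw [← sub_smul, smul_inv_smul₀ hez']
    rw [add_sub_assoc, ← neg_sub (e • _), this, ← sub_eq_add_neg]

/-- A positive form whose operator has compact resolvent is bounded below by every
number smaller than the smallest eigenvalue of the operator. -/
theorem shift_self_nonneg_of_lt_isLeast [CompleteSpace H] (hp : Q.IsPositive)
    (hd : Q.IsDenselyDefined) (hc : HasCompactResolvent Q.operator) {E₀ : ℝ}
    (hE₀ : IsLeast (eigenvalues Q.operator) E₀) {e : ℝ} (he : e < E₀) (v : Q.domain) :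
    0 ≤ Q.shift e v v := by
  have hshift : ∀ (b : ℝ) (u : Q.domain), Q.shift b u u = Q.bilin u u - b * ‖(u : H)‖ ^ 2 :=
    fun b u => by rw [shift_apply, real_inner_self_eq_norm_sq]
  by_contra! hv
  set M : Set ℝ := {b | ∀ u, 0 ≤ Q.shift b u u} with hM
  have hM0 : (0 : ℝ) ∈ M := fun u => by
    rw [hshift, zero_mul, sub_zero]
    exact hp u
  have hMe : ∀ b ∈ M, b ≤ e := by
    intro b hb
    have h1 := hb v
    rw [hshift] at h1 hv
    by_contra! hlt
    nlinarith [sq_nonneg ‖(v : H)‖]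
  have hbdd : BddAbove M := ⟨e, hMe⟩
  -- The best lower bound `β` is attained and at most `e < E₀`, so it is not an eigenvalue; the
  -- bounded resolvent at `β` will then produce a better lower bound.
  set β := sSup M with hβ
  have hβM : β ∈ M := by
    intro u
    rw [hshift]
    by_contra! hlt
    have hu : 0 < ‖(u : H)‖ ^ 2 := by
      by_contra! h0
      have h0' : ‖(u : H)‖ ^ 2 = 0 := le_antisymm h0 (sq_nonneg _)
      rw [h0', mul_zero, sub_zero] at hlt
      exact absurd (hp u) (not_le.mpr hlt)
    have : β ≤ Q.bilin u u / ‖(u : H)‖ ^ 2 := by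
      refine csSup_le ⟨0, hM0⟩ fun b hb => ?_
      rw [le_div_iff₀ hu]
      have := hb u
      rw [hshift] at this
      linarith
    rw [le_div_iff₀ hu] at this
    linarith
  have hβe : β ∉ eigenvalues Q.operator := fun h =>
    absurd (hE₀.2 h) (not_le.mpr ((hMe β hβM).trans_lt he))
  obtain ⟨S, hS⟩ := exists_bounded_resolvent hd hc hβe
  have hsymm : LinearMap.IsSymm (Q.shift β) := ⟨fun u w => by
    simp only [RingHom.id_apply]
    rw [shift_apply, shift_apply, Q.symm, real_inner_comm]⟩
  -- Cauchy–Schwarz for the nonnegative form `p = Q.shift β` gives `‖u‖⁴ = p(S u, u)² ≤ (u, S u)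
  -- p(u, u)`, hence `‖u‖² ≤ (‖S‖ + 1) p(u, u)`. The `+ 1` covers `S = 0`.
  have hmem : β + (‖S‖ + 1)⁻¹ ∈ M := by
    intro u
    obtain ⟨hg, hgu⟩ := hS u
    have hcs := LinearMap.BilinForm.apply_sq_le_of_symm (Q.shift β) hβM hsymm ⟨S u, hg⟩ u
    rw [hgu, hgu, real_inner_self_eq_norm_sq] at hcs
    have h1 : inner ℝ (u : H) (S u) ≤ (‖S‖ + 1) * ‖(u : H)‖ ^ 2 := by
      have h2 := real_inner_le_norm (u : H) (S u)
      have h3 := S.le_opNorm (u : H)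
      nlinarith [norm_nonneg (u : H), sq_nonneg ‖(u : H)‖]
    have hq := hβM u
    have hN : 0 < ‖S‖ + 1 := by positivity
    have e1 : Q.shift (β + (‖S‖ + 1)⁻¹) u u
        = Q.shift β u u - (‖S‖ + 1)⁻¹ * ‖(u : H)‖ ^ 2 := by
      rw [hshift, hshift]; ring
    rw [e1, sub_nonneg, inv_mul_le_iff₀ hN]
    rcases eq_or_lt_of_le (sq_nonneg ‖(u : H)‖) with h0 | h0
    · rw [← h0]; positivity
    · refine le_of_mul_le_mul_left ?_ h0
      calc ‖(u : H)‖ ^ 2 * ‖(u : H)‖ ^ 2 = (‖(u : H)‖ ^ 2) ^ 2 := by ring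
        _ ≤ inner ℝ (u : H) (S u) * Q.shift β u u := hcs
        _ ≤ (‖S‖ + 1) * ‖(u : H)‖ ^ 2 * Q.shift β u u := by gcongr
        _ = ‖(u : H)‖ ^ 2 * ((‖S‖ + 1) * Q.shift β u u) := by ring
  have h1 := le_csSup hbdd hmem
  have h2 : 0 < (‖S‖ + 1)⁻¹ := by positivity
  linarith

/-- The graph of `L + c`, where `L` is the operator associated with the form `Q`. -/
def shiftedGraph (Q : SymmForm H) (c : ℝ) : Submodule ℝ (H × H) :=
  Q.operatorGraph.comap
    ((LinearMap.fst ℝ H H).prod (LinearMap.snd ℝ H H - c • LinearMap.fst ℝ H H))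

theorem mem_shiftedGraph {c : ℝ} {u f : H} :
    (u, f) ∈ Q.shiftedGraph c ↔ ∃ hu : u ∈ Q.domain, ∀ v : Q.domain,
      Q.bilin ⟨u, hu⟩ v + c * inner ℝ u (v : H) = inner ℝ f (v : H) := by
  have : (u, f) ∈ Q.shiftedGraph c ↔ ∃ hu : u ∈ Q.domain, ∀ v : Q.domain,
      Q.bilin ⟨u, hu⟩ v = inner ℝ (f - c • u) (v : H) := Iff.rfl
  rw [this]
  simp only [inner_sub_left, real_inner_smul_left, eq_sub_iff_add_eq]

theorem isMaxAccretive_shiftedGraph [CompleteSpace H] (hd : Q.IsDenselyDefined) {c : ℝ}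
    (hc : ∀ u : Q.domain, -c * ‖(u : H)‖ ^ 2 ≤ Q.bilin u u)
    (hr : ∀ κ : ℝ, 1 ≤ κ → ∀ f : H, ∃ u : Q.domain, ∀ v : Q.domain,
      Q.bilin u v + (c + κ) * inner ℝ (u : H) (v : H) = inner ℝ f (v : H)) :
    IsMaxAccretive (Q.shiftedGraph c) := by
  have hacc : ∀ p ∈ Q.shiftedGraph c, 0 ≤ inner ℝ p.2 p.1 := by
    rintro ⟨u, f⟩ h
    obtain ⟨hu, h⟩ := mem_shiftedGraph.mp h
    have h1 := h ⟨u, hu⟩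
    have h2 := hc ⟨u, hu⟩
    simp only [real_inner_self_eq_norm_sq] at h1 h2 ⊢
    linarith
  have hrange : ∀ κ : ℝ, 1 ≤ κ → ∀ f : H, ∃ u, (u, f - κ • u) ∈ Q.shiftedGraph c := by
    intro κ hκ f
    obtain ⟨u, hu⟩ := hr κ hκ f
    refine ⟨u, mem_shiftedGraph.mpr ⟨u.2, fun v => ?_⟩⟩
    rw [inner_sub_left, real_inner_smul_left, ← hu v]
    simp only [Subtype.coe_eta]
    ring
  refine ⟨hacc, hrange, ?_⟩
  -- Let `g` be orthogonal to the operator domain and `(A + 1) u = g`. Accretivity gives `-‖u‖² ≥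
  -- 0`, so `u = 0`, and then `g` is orthogonal to the dense form domain.
  rw [Submodule.dense_iff_topologicalClosure_eq_top, Submodule.topologicalClosure_eq_top_iff,
    Submodule.eq_bot_iff]
  intro g hg
  obtain ⟨u, hu⟩ := hrange 1 le_rfl g
  have h1 := hacc _ hu
  have h2 : inner ℝ u g = 0 := (Submodule.mem_orthogonal _ _).mp hg u ⟨_, hu, rfl⟩
  simp only [one_smul, inner_sub_left, real_inner_self_eq_norm_sq] at h1
  rw [real_inner_comm, h2] at h1
  have h0 : u = 0 := by
    rw [← norm_eq_zero]
    nlinarith [norm_nonneg u]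
  subst h0
  obtain ⟨hu0, h⟩ := mem_shiftedGraph.mp hu
  refine hd.eq_zero_of_inner_left ℝ fun v hv => ?_
  have h3 := h ⟨v, hv⟩
  have h4 : Q.bilin (0 : Q.domain) ⟨v, hv⟩ = 0 := by simp
  simp only [smul_zero, sub_zero, inner_zero_left, mul_zero, add_zero] at h3
  exact h3.symm.trans h4

end Operator

/-! ### Positivity of resolvents. -/

section Positivity

variable {X : Type*} [MeasurableSpace X] {m : Measure X} {Q : SymmForm (Lp ℝ 2 m)}

theorem inner_nonneg_of_nonneg {f g : Lp ℝ 2 m} (hf : 0 ≤ f) (hg : 0 ≤ g) :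
    0 ≤ inner ℝ f g := by
  rw [L2.inner_def]
  refine integral_nonneg_of_ae ?_
  filter_upwards [(Lp.coeFn_nonneg f).mpr hf, (Lp.coeFn_nonneg g).mpr hg] with x hx hy
  simp only [Pi.zero_apply] at hx hy ⊢
  exact mul_nonneg hy hx

/-- The first Beurling–Deny criterion for resolvents. -/
theorem IsSemiDirichlet.nonneg_of_mem_shiftedGraph (hQ : Q.IsSemiDirichlet) {c : ℝ}
    (hc : ∀ u : Q.domain, -c * ‖(u : Lp ℝ 2 m)‖ ^ 2 ≤ Q.bilin u u) {κ : ℝ} (hκ : 0 < κ)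
    {u f : Lp ℝ 2 m} (h : (u, f - κ • u) ∈ Q.shiftedGraph c) (hf : 0 ≤ f) : 0 ≤ u := by
  obtain ⟨hu, h⟩ := mem_shiftedGraph.mp h
  obtain ⟨hw, hle⟩ := hQ ⟨u, hu⟩
  simp only at hw hle
  set U : Q.domain := ⟨u, hu⟩
  set W : Q.domain := ⟨|u|, hw⟩
  have h1 := h U
  have h2 := h W
  have h3 := hc (W - U)
  have h4 : Q.bilin (W - U) (W - U) = Q.bilin W W - 2 * Q.bilin U W + Q.bilin U U := by
    simp only [map_sub, LinearMap.sub_apply]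
    rw [Q.symm W U]
    ring
  have h5 : ‖((W - U : Q.domain) : Lp ℝ 2 m)‖ ^ 2
      = ‖u‖ ^ 2 - 2 * inner ℝ u |u| + ‖u‖ ^ 2 := by
    have : ((W - U : Q.domain) : Lp ℝ 2 m) = |u| - u := rfl
    rw [this, norm_sub_sq_real, norm_abs_eq_norm, real_inner_comm]
  have h6 : 0 ≤ inner ℝ f |u| - inner ℝ f u := by
    rw [← inner_sub_right]
    exact inner_nonneg_of_nonneg hf (sub_nonneg.mpr (le_abs_self u))
  have hW : (W : Lp ℝ 2 m) = |u| := rfl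
  have hU : (U : Lp ℝ 2 m) = u := rfl
  rw [inner_sub_left, real_inner_smul_left] at h1 h2
  rw [hU, real_inner_self_eq_norm_sq] at h1
  rw [hW] at h2
  -- Testing the equation with `|u| - u ≥ 0` and using `Q[|u|] ≤ Q[u]` gives `Q[|u| - u] ≤ -(c + κ)
  -- ‖|u| - u‖²`, against the lower bound `-c ‖|u| - u‖²`.
  have h7 : κ * ‖((W - U : Q.domain) : Lp ℝ 2 m)‖ ^ 2 ≤ 0 := by
    rw [h4, h5] at h3
    rw [h5]
    linarith
  have h8 : ((W - U : Q.domain) : Lp ℝ 2 m) = 0 := by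
    rw [← norm_eq_zero]
    have := sq_nonneg ‖((W - U : Q.domain) : Lp ℝ 2 m)‖
    have h9 : ‖((W - U : Q.domain) : Lp ℝ 2 m)‖ ^ 2 = 0 := le_antisymm (by nlinarith) this
    exact pow_eq_zero_iff two_ne_zero |>.mp h9
  have h10 : |u| - u = 0 := h8
  rw [← sub_eq_zero.mp h10]
  exact abs_nonneg u

end Positivity

end SymmForm

/-! ### The harmonic decomposition and the trace form. -/

namespace SymmForm

variable {H K : Type*} [NormedAddCommGroup H] [InnerProductSpace ℝ H]
  [NormedAddCommGroup K] [InnerProductSpace ℝ K] {E : SymmForm H} {J : E.domain →ₗ[ℝ] K}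

/-- An element of `ker J`, viewed in the domain of the Dirichlet form. -/
def toDirichlet (u : LinearMap.ker J) : (E.dirichlet J).domain :=
  ⟨((u : E.domain) : H), ⟨u, u.2, rfl⟩⟩

theorem exists_toDirichlet_eq (w : (E.dirichlet J).domain) :
    ∃ u : LinearMap.ker J, toDirichlet u = w := by
  obtain ⟨_, u, hu, rfl⟩ := w
  exact ⟨⟨u, hu⟩, rfl⟩

theorem dirichlet_shift (lam : ℝ) (u v : LinearMap.ker J) :
    (E.dirichlet J).shift lam (toDirichlet u) (toDirichlet v) = E.shift lam (u : E.domain) v := by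
  rw [shift_apply, shift_apply]
  rfl

theorem shift_symm (lam : ℝ) (u v : E.domain) : E.shift lam u v = E.shift lam v u := by
  rw [shift_apply, shift_apply, E.symm, real_inner_comm]

/-- A nonzero element of the intersection would be an eigenvector of `L_D`. For the sum, start from
the decomposition at `0`: if `a` is `0`-harmonic and `(L_D - lam) w = lam a`, then `a + w` is
`lam`-harmonic. -/
theorem isCompl_harmonic [CompleteSpace H] (hd : (E.dirichlet J).IsDenselyDefined)
    (hc : HasCompactResolvent (E.dirichlet J).operator)
    (hsum : IsCompl (E.harmonic J 0) (LinearMap.ker J)) {lam : ℝ}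
    (hlam : lam ∉ eigenvalues (E.dirichlet J).operator) :
    IsCompl (E.harmonic J lam) (LinearMap.ker J) := by
  refine IsCompl.of_eq ?_ ?_
  · rw [Submodule.eq_bot_iff]
    rintro u ⟨hu, huJ⟩
    by_contra hu0
    refine hlam (mem_eigenvalues hd (u := toDirichlet ⟨u, huJ⟩) (fun h => hu0 ?_) fun v => ?_)
    · exact Subtype.ext (congrArg (fun x : (E.dirichlet J).domain => (x : H)) h)
    · obtain ⟨v, rfl⟩ := exists_toDirichlet_eq v
      rw [dirichlet_shift]
      exact hu v v.2
  · rw [Submodule.eq_top_iff']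
    intro u
    have hu : u ∈ E.harmonic J 0 ⊔ LinearMap.ker J := hsum.sup_eq_top ▸ Submodule.mem_top
    obtain ⟨a, ha, b, hb, rfl⟩ := Submodule.mem_sup.mp hu
    obtain ⟨S, hS⟩ := exists_bounded_resolvent hd hc hlam
    obtain ⟨hw, hwv⟩ := hS (lam • (a : H))
    obtain ⟨w, hw'⟩ := exists_toDirichlet_eq ⟨_, hw⟩
    rw [← hw'] at hwv
    refine Submodule.mem_sup.mpr ⟨a + w, fun v hv => ?_, b - w, Submodule.sub_mem _ hb w.2, by abel⟩
    have h1 := hwv (toDirichlet ⟨v, hv⟩)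
    have h2 := ha v hv
    rw [dirichlet_shift] at h1
    have h3 : inner ℝ (lam • (a : H)) ((toDirichlet (⟨v, hv⟩ : LinearMap.ker J) :
        (E.dirichlet J).domain) : H) = lam * inner ℝ (a : H) (v : H) :=
      real_inner_smul_left _ _ _
    rw [h3] at h1
    rw [shift_apply, zero_mul, sub_zero] at h2
    rw [map_add, LinearMap.add_apply, h1, shift_apply, h2]
    ring

section Trace

variable {lam : ℝ} (h : IsCompl (E.harmonic J lam) (LinearMap.ker J))

theorem poisson_J {u : E.domain} (hu : u ∈ E.harmonic J lam) :
    poisson h ⟨J u, LinearMap.mem_range_self J u⟩ = u := by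
  have h1 : poisson h ⟨J u, LinearMap.mem_range_self J u⟩ - u = 0 :=
    Submodule.disjoint_def.mp h.disjoint _ (Submodule.sub_mem _ (poisson_mem h _) hu)
      (by simp [J_poisson])
  exact sub_eq_zero.mp h1

theorem trace_lower_bound {c : ℝ}
    (hc : ∀ u ∈ E.harmonic J lam, -c * ‖J u‖ ^ 2 ≤ E.shift lam u u) (ψ : (trace h).domain) :
    -c * ‖(ψ : K)‖ ^ 2 ≤ (trace h).bilin ψ ψ := by
  have h1 : ∀ ψ : LinearMap.range J,
      -c * ‖(ψ : K)‖ ^ 2 ≤ E.shift lam (poisson h ψ) (poisson h ψ) := fun ψ => by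
    simpa only [J_poisson] using hc _ (poisson_mem h ψ)
  exact h1 ψ

/-- Riesz representation of `v ↦ (f, J v)` on the harmonic space, bounded there because `E_lam[v] +
(c + κ)‖J v‖² ≥ ‖J v‖²`. The solution `w` is carried to `range J` by `J`. -/
theorem exists_trace_resolvent {c : ℝ}
    (hc : ∀ u ∈ E.harmonic J lam, -c * ‖J u‖ ^ 2 ≤ E.shift lam u u)
    (hH : IsHilbertInner ((E.shiftAdd J lam (1 + c)).restrict (E.harmonic J lam)))
    {κ : ℝ} (hκ : 1 ≤ κ) (f : K) : ∃ ψ : (trace h).domain, ∀ φ : (trace h).domain,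
      (trace h).bilin ψ φ + (c + κ) * inner ℝ (ψ : K) (φ : K) = inner ℝ f (φ : K) := by
  have happ : ∀ (a : ℝ) (u v : E.harmonic J lam), (E.shiftAdd J lam a).restrict (E.harmonic J lam)
      u v = E.shift lam (u : E.domain) v + a * inner ℝ (J u) (J v) := by
    intro a u v
    simp [shiftAdd]
  have hH' : IsHilbertInner ((E.shiftAdd J lam (c + κ)).restrict (E.harmonic J lam)) := by
    -- The upper bound with factor `κ` amounts to `(κ - 1) (E_lam[u] + c ‖J u‖²) ≥ 0`.
    refine hH.of_equivalent (M := κ) (fun u v => ?_) (fun u => ?_) fun u => ?_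
    · rw [happ, happ, shift_symm, real_inner_comm]
    · rw [happ, happ, real_inner_self_eq_norm_sq]
      nlinarith [sq_nonneg ‖J (u : E.domain)‖]
    · rw [happ, happ, real_inner_self_eq_norm_sq]
      have := hc u u.2
      nlinarith [sq_nonneg ‖J (u : E.domain)‖]
  obtain ⟨w, hw⟩ := hH'.exists_representer
    ((innerₗ K f) ∘ₗ J ∘ₗ (E.harmonic J lam).subtype) (C := ‖f‖ ^ 2) fun v => by
      have h1 : ((innerₗ K f) ∘ₗ J ∘ₗ (E.harmonic J lam).subtype) v = inner ℝ f (J v) := rfl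
      rw [h1, happ, real_inner_self_eq_norm_sq]
      have h2 := hc v v.2
      have h3 : ‖J (v : E.domain)‖ ^ 2
          ≤ E.shift lam (v : E.domain) v + (c + κ) * ‖J (v : E.domain)‖ ^ 2 := by
        nlinarith [sq_nonneg ‖J (v : E.domain)‖]
      calc inner ℝ f (J v) ^ 2 = |inner ℝ f (J v)| ^ 2 := (sq_abs _).symm
        _ ≤ (‖f‖ * ‖J (v : E.domain)‖) ^ 2 := by gcongr; exact abs_real_inner_le_norm _ _
        _ = ‖f‖ ^ 2 * ‖J (v : E.domain)‖ ^ 2 := by ring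
        _ ≤ _ := by gcongr
  have key : ∀ φ : LinearMap.range J,
      E.shift lam (poisson h ⟨J w, LinearMap.mem_range_self J _⟩) (poisson h φ)
        + (c + κ) * inner ℝ (J w) (φ : K) = inner ℝ f (φ : K) := fun φ => by
    have h1 := hw ⟨poisson h φ, poisson_mem h φ⟩
    have h2 : ((innerₗ K f) ∘ₗ J ∘ₗ (E.harmonic J lam).subtype) ⟨poisson h φ, poisson_mem h φ⟩
        = inner ℝ f (J (poisson h φ)) := rfl
    rw [happ, h2] at h1
    simpa only [poisson_J h w.2, J_poisson] using h1
  exact ⟨⟨J w, LinearMap.mem_range_self J _⟩, key⟩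

/-- If `E - lam` is nonnegative on `ker J`, harmonic functions minimize the form `E - lam`. -/
theorem shift_poisson_le (hpos : ∀ v ∈ LinearMap.ker J, 0 ≤ E.shift lam v v)
    {ψ : LinearMap.range J} {u : E.domain} (hu : J u = ψ) :
    E.shift lam (poisson h ψ) (poisson h ψ) ≤ E.shift lam u u := by
  have hv : u - poisson h ψ ∈ LinearMap.ker J := by simp [J_poisson, hu]
  have hpv := poisson_mem h ψ _ hv
  have h1 := hpos _ hv
  have h2 : E.shift lam u u = E.shift lam (poisson h ψ) (poisson h ψ)
      + 2 * E.shift lam (poisson h ψ) (u - poisson h ψ)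
      + E.shift lam (u - poisson h ψ) (u - poisson h ψ) := by
    simp only [map_sub, LinearMap.sub_apply]
    rw [shift_symm lam u (poisson h ψ)]
    ring
  linarith

end Trace

/-- The modulus of the harmonic extension of `ψ` need not be harmonic, but it is a competitor in the
minimization for `|ψ|`. The shift by `lam` is harmless whatever its sign, as `|u|` and `u` have the
same norm. -/
theorem trace_isSemiDirichlet {X Y : Type*} [MeasurableSpace X] [MeasurableSpace Y]
    {m : Measure X} {μ : Measure Y} {E : SymmForm (Lp ℝ 2 m)} (hsemi : E.IsSemiDirichlet)
    {J : E.domain →ₗ[ℝ] Lp ℝ 2 μ}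
    (hJabs : ∀ u v : E.domain, (v : Lp ℝ 2 m) = |(u : Lp ℝ 2 m)| → J v = |J u|) {lam : ℝ}
    (h : IsCompl (E.harmonic J lam) (LinearMap.ker J))
    (hpos : ∀ v ∈ LinearMap.ker J, 0 ≤ E.shift lam v v) : (trace h).IsSemiDirichlet := by
  intro ψ
  set u := poisson h ψ with hu
  have hJu : J u = ψ := J_poisson h ψ
  obtain ⟨ha, hle⟩ := hsemi u
  set a : E.domain := ⟨|(u : Lp ℝ 2 m)|, ha⟩
  have hJa : J a = |(ψ : Lp ℝ 2 μ)| := by rw [hJabs u a rfl, hJu]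
  have hmem : |(ψ : Lp ℝ 2 μ)| ∈ (trace h).domain := ⟨a, hJa⟩
  refine ⟨hmem, ?_⟩
  refine (shift_poisson_le h hpos (ψ := ⟨|(ψ : Lp ℝ 2 μ)|, hmem⟩) hJa).trans ?_
  change _ ≤ E.shift lam u u
  rw [shift_apply, shift_apply, real_inner_self_eq_norm_sq, real_inner_self_eq_norm_sq]
  have h3 : ‖(a : Lp ℝ 2 m)‖ = ‖(u : Lp ℝ 2 m)‖ := norm_abs_eq_norm _
  rw [h3]
  linarith

/-- The cone of nonnegative functions in `L²`. -/
def nonnegCone {Y : Type*} [MeasurableSpace Y] (μ : Measure Y) : PointedCone ℝ (Lp ℝ 2 μ) where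
  carrier := Set.Ici 0
  add_mem' ha hb := add_nonneg (Set.mem_Ici.mp ha) hb
  zero_mem' := Set.mem_Ici.mpr le_rfl
  smul_mem' c f hf := by
    refine (Lp.coeFn_nonneg _).mp ?_
    filter_upwards [(Lp.coeFn_nonneg f).mpr hf, Lp.coeFn_smul (c : ℝ) f] with x hx hcx
    exact (mul_nonneg c.2 hx).trans_eq hcx.symm

theorem isClosed_nonnegCone {Y : Type*} [MeasurableSpace Y] (μ : Measure Y) :
    IsClosed (nonnegCone μ : Set (Lp ℝ 2 μ)) :=
  show IsClosed (Set.Ici (0 : Lp ℝ 2 μ)) from isClosed_Ici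

end SymmForm

/-! ### The Dirichlet-to-Neumann semigroup. -/

theorem mainTheorem7 {X Y : Type*} [MeasurableSpace X] [MeasurableSpace Y]
    (m : Measure X) [SigmaFinite m] (μ : Measure Y) [SigmaFinite μ]
    (E : SymmForm (Lp ℝ 2 m))
    (hpos : E.IsPositive) (hdense : E.IsDenselyDefined) (hclosed : E.IsClosedForm)
    (hsemi : E.IsSemiDirichlet)
    (J : E.domain →ₗ[ℝ] Lp ℝ 2 μ) (hJrange : DenseRange J)
    (hJabs : ∀ u v : E.domain, (v : Lp ℝ 2 m) = |(u : Lp ℝ 2 m)| → J v = |J u|)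
    (hDdense : (E.dirichlet J).IsDenselyDefined)
    (hDclosed : (E.dirichlet J).IsClosedForm)
    (hDcompact : HasCompactResolvent (E.dirichlet J).operator)
    (hsum : IsCompl (E.harmonic J 0) (LinearMap.ker J))
    (htrace : ∀ lam : ℝ, lam ∉ eigenvalues (E.dirichlet J).operator →
      ∃ c : ℝ, 0 < c ∧
        (∀ u ∈ E.harmonic J lam, -c * ‖J u‖ ^ 2 ≤ E.shift lam u u) ∧
        IsHilbertInner ((E.shiftAdd J lam (1 + c)).restrict (E.harmonic J lam)))
    (E₀ : ℝ) (hE₀ : IsLeast (eigenvalues (E.dirichlet J).operator) E₀)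
    (lam : ℝ) (hlam : lam < E₀) :
    ∃ h : IsCompl (E.harmonic J lam) (LinearMap.ker J),
      (∃ T : ℝ≥0 → Lp ℝ 2 μ →L[ℝ] Lp ℝ 2 μ,
        IsSemigroupOf (SymmForm.trace h).operator T) ∧
      ∀ T : ℝ≥0 → Lp ℝ 2 μ →L[ℝ] Lp ℝ 2 μ,
        IsSemigroupOf (SymmForm.trace h).operator T → ∀ t, PositivityPreserving (T t) := by
  have hlam' : lam ∉ eigenvalues (E.dirichlet J).operator := fun h =>
    absurd (hE₀.2 h) (not_le.mpr hlam)
  have h := SymmForm.isCompl_harmonic hDdense hDcompact hsum hlam'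
  have hDpos : (E.dirichlet J).IsPositive := fun u => by
    obtain ⟨u, rfl⟩ := SymmForm.exists_toDirichlet_eq u
    exact hpos u
  -- Here `lam < E₀` is essential: existence of the semigroup needs only that `lam` is not an
  -- eigenvalue, positivity needs this sign.
  have hker : ∀ v ∈ LinearMap.ker J, 0 ≤ E.shift lam v v := fun v hv => by
    rw [← SymmForm.dirichlet_shift lam ⟨v, hv⟩ ⟨v, hv⟩]
    exact SymmForm.shift_self_nonneg_of_lt_isLeast hDpos hDdense hDcompact hE₀ hlam _
  have hd : (SymmForm.trace h).IsDenselyDefined := by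
    have : ((SymmForm.trace h).domain : Set (Lp ℝ 2 μ)) = Set.range J := LinearMap.coe_range J
    rw [SymmForm.IsDenselyDefined, this]
    exact hJrange
  obtain ⟨c, -, hc, hH⟩ := htrace lam hlam'
  have hlow := SymmForm.trace_lower_bound h hc
  have hG := SymmForm.isMaxAccretive_shiftedGraph hd hlow
    fun κ hκ f => SymmForm.exists_trace_resolvent h hc hH hκ f
  have hgraph : ∀ u f : Lp ℝ 2 μ, (u, f) ∈ (SymmForm.trace h).operator.graph ↔
      (u, f + c • u) ∈ (SymmForm.trace h).shiftedGraph c := fun u f => by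
    simp only [SymmForm.mem_graph_operator hd, SymmForm.mem_shiftedGraph, inner_add_left,
      real_inner_smul_left, add_left_inj]
  have hS := hG.isSemigroupOf hgraph
  have hdom : Dense ((SymmForm.trace h).operator.domain : Set (Lp ℝ 2 μ)) := by
    refine hG.dense.mono ?_
    rintro _ ⟨⟨u, f⟩, hu, rfl⟩
    have h1 := (hgraph u (f - c • u)).mpr (by simpa using hu)
    exact LinearPMap.mem_domain_of_mem_graph h1
  have hlow' : ∀ p ∈ (SymmForm.trace h).operator.graph,
      -c * ‖p.1‖ ^ 2 ≤ inner ℝ p.2 p.1 := by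
    rintro ⟨u, f⟩ hp
    obtain ⟨hu, hv⟩ := (SymmForm.mem_graph_operator hd).mp hp
    exact (hlow ⟨u, hu⟩).trans_eq (hv ⟨u, hu⟩)
  refine ⟨h, ⟨_, hS⟩, fun T hT t f hf => ?_⟩
  -- Uniqueness replaces the arbitrary `T` by the Yosida limit, for which invariance of the cone is
  -- available.
  rw [hT.unique hS hdom hlow']
  have hsd := SymmForm.trace_isSemiDirichlet hsemi hJabs h hker
  exact (SymmForm.nonnegCone μ).smul_mem (Real.exp_pos _).le
    (hG.semigroup_mem (SymmForm.isClosed_nonnegCone μ) (fun κ hκ g hg =>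
      hsd.nonneg_of_mem_shiftedGraph hlow (by linarith) (hG.resolvent_mem hκ g) hg) t hf)
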